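/- **Setting.** Let $M$ be a smooth $n$-manifold, $TM'$ its tangent bundle without the zero section, and $\mathscr H\subset TM$ a set. Let $\lambda=dx^i\otimes\frac{\partial}{\partial v^i}$ be the vertical endomorphism of $TTM$, and write $\mathscr L$ for the Lie derivative. A *defining function of $\mathscr H$ of degree $k$* ($k\in\mathbb R$, $k\ne1$) over an open set $U\subset TM'$ invariant under the scalings $(x,v)\mapsto(x,tv)$, $t>0$, is a smooth function $G$ on $U$ with $G(x,tv)=t^kG(x,v)$ for $t>0$ and $\{G=0\}=\mathscr H\cap U$, such that at every point of $\mathscr H\cap U$ the fibre derivative $\partial G/\partial v^i$ is nonzero and the fibre Hessian $g_{ij}=\partial^2G/\partial v^i\partial v^j$ is nondegenerate. Given $G$, let $\alpha=\frac{\partial G}{\partial v^i}dx^i$, $g_h=g_{ij}\,dx^i\otimes dx^j$, $g_v=g_{ij}\,dv^i\otimes dv^j$ (on vertical vectors). Near $\mathscr H\cap U$ let $V$ be the vector field with $V\lrcorner\,d\alpha=-(k-1)\,dG$, where $d\alpha(X,Y)=X\alpha(Y)-Y\alpha(X)-\alpha([X,Y])$; let $P=\frac12(\mathrm{Id}+\mathscr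 L_V\lambda)$, and let the tidal force tensor $S$ be given by $\frac12(\mathscr L_V^2g_h)(X,Y)=g_v(PX,PY)+S(X,Y)$. At a point of $\mathscr H\cap U$ let $T\mathscr H=\ker dG$, let $V\mathscr H$ be the space of vertical vectors in $T\mathscr H$, let $\Lambda_{\mathscr H}=\{X\in T\mathscr H:\lambda X\in V\mathscr H\}$, and let $E=\Lambda_{\mathscr H}/(V\mathscr H\oplus\langle V\rangle)$ be the umbral space. Let $g_E$ be the metric induced on $E$ by $g_h$, and $S_E^\sharp\in\operatorname{End}(E)$ the endomorphism with $g_E(S_E^\sharp X,Y)=S(X,Y)$. The Weyl tensor is the trace-free part of $S$ on $E$, $$W(X,Y)=S(X,Y)-\frac{\operatorname{tr}S_E^\sharp}{n-2}\,g_E(X,Y),\qquad g_E(W^\sharp X,Y)=W(X,Y)$$ (for $n=2$, $E=0$ and $W=0$). **Theorem.** 1. At every point of $\mathscr H\cap U$ these objects are well defined: $V\mathscr H\oplus\langle V\rangle\subset\Lambda_{\mathscr H}$ is the kernel of $g_h|_{\Lambda_{\mathscr H}\times\Lambda_{\mathscr H}}$, $\dim E=n-2$, and $S$ is symmetric and vanishes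 if one of its arguments lies in $V\mathscr H\oplus\langle V\rangle$. 2. The Weyl tensor, as an endomorphism $W^\sharp$ of $E$, depends only on $\mathscr H$: if $G$ over $U$ and $\widehat G$ over $\widehat U$ are defining functions of $\mathscr H$, of possibly different degrees, then at every point of $\mathscr H\cap U\cap\widehat U$ they give the same $\Lambda_{\mathscr H}$, the same subspace $V\mathscr H\oplus\langle V\rangle$, hence the same $E$, and the same $W^\sharp\in\operatorname{End}(E)$; moreover there is a real $c\neq0$, depending on the point, with $\widehat g_E=c\,g_E$ and $\widehat W=c\,W$ as bilinear forms. 3. In particular $W^\sharp$ is invariant under generalized conformal transformations: let $G$ be a defining function of degree $k$ over $U$, and $J$ a smooth nowhere zero function on a scaling-invariant open set $U_1\subset TM'$, with $J(x,tv)=t^qJ(x,v)$ for $t>0$ and $k+q\ne1$. Then $\widehat G=JG$ is a defining function of $\mathscr H$ of degree $k+q$ over $U\cap U_1$, and on $\mathscr H\cap U\cap U_1$ it gives the same $\Lambda_{\mathscr H}$, $V\mathscr H\oplus\langle V\rangle$, $E$ and $W^\sharp$, while $\widehat g_E=J\,g_E$ and $\widehat W=J\,W$. -/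

import Mathlib

open scoped Manifold ContDiff Topology

noncomputable section

namespace CausalGeometry

/-! ## Causal geometry in a chart

A chart of an `n`-manifold modelled on `E` identifies an open part of `TM` with an open subset of
`E × E`, with points `z = (x, v)` and tangent vectors `X = (ξ, ν)`, that is
`X = ξⁱ ∂/∂xⁱ + νⁱ ∂/∂vⁱ`.  All the constructions of this part (the vertical endomorphism, exterior
derivative, Lie derivative, fibre Hessian) are natural under changes of charts of `M`. -/

section Chart

variable {E : Type*} [NormedAddCommGroup E] [NormedSpace ℝ E]

/-- The vertical endomorphism `λ : TTM → VTM`, `λ = dxⁱ ⊗ ∂/∂vⁱ`, i.e. `λ (ξ, ν) = (0, ξ)`. -/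
def vertEnd : E × E →L[ℝ] E × E :=
  (ContinuousLinearMap.inr ℝ E E).comp (ContinuousLinearMap.fst ℝ E E)

/-- The one-form `α = DG`, i.e. `α (X) = dG (λ X)`; in coordinates `α = (∂G/∂vⁱ) dxⁱ`. -/
def contactForm (G : E × E → ℝ) (z : E × E) : E × E →L[ℝ] ℝ :=
  (fderiv ℝ G z).comp vertEnd

/-- The exterior derivative `dα`, `dα (X, Y) = X (α Y) - Y (α X) - α [X, Y]`. -/
def dContact (G : E × E → ℝ) (z : E × E) : E × E →L[ℝ] E × E →L[ℝ] ℝ :=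
  fderiv ℝ (contactForm G) z - (fderiv ℝ (contactForm G) z).flip

/-- The dynamical vector field `V` of a function `G` that is homogeneous of degree `k`: the solution
of `V ⌟ dα = -(k - 1) dG`.  In coordinates `V = vⁱ ∂/∂xⁱ + uⁱ ∂/∂vⁱ` with
`uⁱ gᵢⱼ = ∂G/∂xʲ - vⁱ ∂²G/∂xⁱ∂vʲ`.  (`inverse` is the inverse of the linear map `X ↦ dα (X, ·)`,
which is invertible wherever the fibre Hessian of `G` is nondegenerate.) -/
def spray (k : ℝ) (G : E × E → ℝ) (z : E × E) : E × E :=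
  (-(k - 1)) • (dContact G z).inverse (fderiv ℝ G z)

/-- The fibre Hessian `gᵢⱼ = ∂²G/∂vⁱ∂vʲ`, a bilinear form on `T_x M`. -/
def fibreHess (G : E × E → ℝ) (z : E × E) : E →L[ℝ] E →L[ℝ] ℝ :=
  (fderiv ℝ (fderiv ℝ G) z).bilinearComp
    (ContinuousLinearMap.inr ℝ E E) (ContinuousLinearMap.inr ℝ E E)

/-- The horizontal metric `g_h = gᵢⱼ dxⁱ ⊗ dxʲ`. -/
def gH (G : E × E → ℝ) (z : E × E) : E × E →L[ℝ] E × E →L[ℝ] ℝ :=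
  (fibreHess G z).bilinearComp (ContinuousLinearMap.fst ℝ E E) (ContinuousLinearMap.fst ℝ E E)

/-- The vertical metric `g_v = gᵢⱼ dvⁱ ⊗ dvʲ`, a bilinear form on the vertical bundle.  (It is only
used on vertical vectors.) -/
def gV (G : E × E → ℝ) (z : E × E) : E × E →L[ℝ] E × E →L[ℝ] ℝ :=
  (fibreHess G z).bilinearComp (ContinuousLinearMap.snd ℝ E E) (ContinuousLinearMap.snd ℝ E E)

/-- The Lie derivative of a field of bilinear forms,
`(𝓛_V B)(X, Y) = V (B (X, Y)) - B ([V, X], Y) - B (X, [V, Y])`, evaluated on constant `X`, `Y`, for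
which `[V, X] = - DV (X)`. -/
def lieForm {F : Type*} [NormedAddCommGroup F] [NormedSpace ℝ F]
    (V : F → F) (B : F → F →L[ℝ] F →L[ℝ] ℝ) (z : F) : F →L[ℝ] F →L[ℝ] ℝ :=
  fderiv ℝ B z (V z) + (B z).bilinearComp (fderiv ℝ V z) (ContinuousLinearMap.id ℝ F)
    + (B z).bilinearComp (ContinuousLinearMap.id ℝ F) (fderiv ℝ V z)

/-- The Lie derivative of a field of endomorphisms, `(𝓛_V A)(X) = [V, A X] - A [V, X]`. -/
def lieEnd {F : Type*} [NormedAddCommGroup F] [NormedSpace ℝ F]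
    (V : F → F) (A : F → F →L[ℝ] F) (z : F) : F →L[ℝ] F :=
  fderiv ℝ A z (V z) - (fderiv ℝ V z).comp (A z) + (A z).comp (fderiv ℝ V z)

/-- The Ehresmann connection `P = ½ (Id + 𝓛_V λ)`. -/
def connP (k : ℝ) (G : E × E → ℝ) (z : E × E) : E × E →L[ℝ] E × E :=
  (1 / 2 : ℝ) •
    (ContinuousLinearMap.id ℝ (E × E) + lieEnd (spray k G) (fun _ => vertEnd) z)

/-- The tidal force tensor `S`, given by `½ (𝓛_V² g_h)(X, Y) = g_v (P X, P Y) + S (X, Y)`. -/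
def tidal (k : ℝ) (G : E × E → ℝ) (z : E × E) : E × E →L[ℝ] E × E →L[ℝ] ℝ :=
  (1 / 2 : ℝ) • lieForm (spray k G) (lieForm (spray k G) (gH G)) z
    - (gV G z).bilinearComp (connP k G z) (connP k G z)

/-- The tangent space `T𝓗` at `z` of the hypersurface `𝓗 = {G = 0}`. -/
def tanCone (G : E × E → ℝ) (z : E × E) : Submodule ℝ (E × E) :=
  LinearMap.ker (fderiv ℝ G z : E × E →ₗ[ℝ] ℝ)

/-- The vertical tangent space `V𝓗 = T𝓗 ∩ VTM`. -/
def vertCone (G : E × E → ℝ) (z : E × E) : Submodule ℝ (E × E) :=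
  tanCone G z ⊓ LinearMap.ker (LinearMap.fst ℝ E E)

/-- The distribution `Λ_𝓗` of all `X ∈ T𝓗` with `λ X ∈ V𝓗`. -/
def lamCone (G : E × E → ℝ) (z : E × E) : Submodule ℝ (E × E) :=
  tanCone G z ⊓ (vertCone G z).comap (vertEnd (E := E)).toLinearMap

/-- The subspace `V𝓗 ⊕ ⟨V⟩`. -/
def nullCone (k : ℝ) (G : E × E → ℝ) (z : E × E) : Submodule ℝ (E × E) :=
  vertCone G z ⊔ Submodule.span ℝ {spray k G z}

/-- The fibre at `z` of the umbral bundle `E = Λ_𝓗 / (V𝓗 ⊕ ⟨V⟩)`. -/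
abbrev Umbral (k : ℝ) (G : E × E → ℝ) (z : E × E) : Type _ :=
  (lamCone G z) ⧸ (nullCone k G z).submoduleOf (lamCone G z)

end Chart

/-! ## Linear algebra: forms on a quotient, raising an index -/

section LinearAlgebra

/-- The bilinear form on `Λ / N` induced by a bilinear form `B` on `Λ` that vanishes as soon as one
of its arguments is in `N`. -/
def descend {Q : Type*} [AddCommGroup Q] [Module ℝ Q] (N : Submodule ℝ Q)
    (B : LinearMap.BilinForm ℝ Q) : LinearMap.BilinForm ℝ (Q ⧸ N) :=
  open Classical in
  if h : ∀ X ∈ N, ∀ Y, B X Y = 0 ∧ B Y X = 0 then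
    N.liftQ (N.liftQ B.flip
        (fun X hX => LinearMap.mem_ker.2 (LinearMap.ext fun Y => (h X hX Y).2))).flip
      (fun X hX => LinearMap.mem_ker.2 (by
        refine LinearMap.ext fun y => ?_
        obtain ⟨Y, rfl⟩ := N.mkQ_surjective y
        exact (h X hX Y).1))
  else 0

/-- Raising an index: the endomorphism `A` with `g (A X, Y) = s (X, Y)`, for nondegenerate `g`. -/
def raiseIndex {Q : Type*} [AddCommGroup Q] [Module ℝ Q] [FiniteDimensional ℝ Q]
    (g s : LinearMap.BilinForm ℝ Q) : Module.End ℝ Q :=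
  open Classical in
  if h : g.Nondegenerate then (g.toDual h).symm.toLinearMap ∘ₗ s else 0

end LinearAlgebra

/-! ## The Weyl tensor -/

section Weyl

variable {E : Type*} [NormedAddCommGroup E] [NormedSpace ℝ E]

/-- A bilinear form on `T(TM)`, restricted to `Λ_𝓗` and regarded as a bilinear form on the umbral
space. -/
def toUmbral (k : ℝ) (G : E × E → ℝ) (z : E × E) (B : E × E →L[ℝ] E × E →L[ℝ] ℝ) :
    LinearMap.BilinForm ℝ (Umbral k G z) :=
  descend _ (B.toLinearMap₁₂.domRestrict₁₂ (lamCone G z) (lamCone G z))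

/-- The metric `g_E` of the umbral space. -/
def umbralMetric (k : ℝ) (G : E × E → ℝ) (z : E × E) : LinearMap.BilinForm ℝ (Umbral k G z) :=
  toUmbral k G z (gH G z)

/-- The tidal force tensor as a bilinear form `S_E` on the umbral space. -/
def umbralTidal (k : ℝ) (G : E × E → ℝ) (z : E × E) : LinearMap.BilinForm ℝ (Umbral k G z) :=
  toUmbral k G z (tidal k G z)

/-- The umbral space and the tensors on it are well defined at `z`: `V𝓗 ⊕ ⟨V⟩` is contained in `Λ_𝓗`
and is the kernel of the restriction of `g_h` to `Λ_𝓗`, the quotient has dimension `n - 2`, and `S`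
is symmetric and vanishes as soon as one argument is in `V𝓗 ⊕ ⟨V⟩`. -/
structure UmbralWellDefined (k : ℝ) (G : E × E → ℝ) (z : E × E) : Prop where
  null_le : nullCone k G z ≤ lamCone G z
  mem_null_iff : ∀ X ∈ lamCone G z, X ∈ nullCone k G z ↔ ∀ Y ∈ lamCone G z, gH G z X Y = 0
  finrank_eq : Module.finrank ℝ (Umbral k G z) + 2 = Module.finrank ℝ E
  tidal_symm : ∀ X Y, tidal k G z X Y = tidal k G z Y X
  tidal_null : ∀ X ∈ nullCone k G z, ∀ Y, tidal k G z X Y = 0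

/-- If two functions `G`, `G'` define the same spaces `Λ_𝓗` and `V𝓗 ⊕ ⟨V⟩` at `z`, then their umbral
spaces at `z` are the same quotient; this is the identification `[X] ↦ [X]`. -/
def umbralCongr {k k' : ℝ} {G G' : E × E → ℝ} {z : E × E} (hΛ : lamCone G z = lamCone G' z)
    (hN : nullCone k G z = nullCone k' G' z) : Umbral k G z ≃ₗ[ℝ] Umbral k' G' z :=
  Submodule.Quotient.equiv _ _ (LinearEquiv.ofEq _ _ hΛ) (by
    ext ⟨X, hX⟩
    simp only [Submodule.mem_map, Submodule.submoduleOf, Submodule.mem_comap, hN]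
    constructor
    · rintro ⟨Y, hY, hYX⟩
      have h : (Y : E × E) = X := congrArg Subtype.val hYX
      simpa [← h] using hY
    · intro h
      exact ⟨⟨X, hΛ ▸ hX⟩, h, rfl⟩)

variable [FiniteDimensional ℝ E]

/-- The endomorphism `S_E^♯` of the umbral space, `g_E (S_E^♯ X, Y) = S (X, Y)`. -/
def tidalSharp (k : ℝ) (G : E × E → ℝ) (z : E × E) : Module.End ℝ (Umbral k G z) :=
  raiseIndex (umbralMetric k G z) (umbralTidal k G z)

/-- The Weyl tensor as a bilinear form: `W = S - (tr S_E^♯ / (n - 2)) g_E`. -/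
def weylForm (k : ℝ) (G : E × E → ℝ) (z : E × E) : LinearMap.BilinForm ℝ (Umbral k G z) :=
  umbralTidal k G z -
    (LinearMap.trace ℝ _ (tidalSharp k G z) / ((Module.finrank ℝ E : ℝ) - 2)) • umbralMetric k G z

/-- The Weyl tensor as an endomorphism: `W^♯`, with `g_E (W^♯ X, Y) = W (X, Y)`. -/
def weylSharp (k : ℝ) (G : E × E → ℝ) (z : E × E) : Module.End ℝ (Umbral k G z) :=
  raiseIndex (umbralMetric k G z) (weylForm k G z)

/-- `G` and `G'` (of degrees `k` and `k'`) define at `z` the same umbral space `Λ_𝓗 / (V𝓗 ⊕ ⟨V⟩)` and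
on it the same Weyl endomorphism `W^♯`, while the metrics `g_E`, and the Weyl tensors `W` as bilinear
forms, differ by the factor `c`. -/
def WeylAgree (k : ℝ) (G : E × E → ℝ) (k' : ℝ) (G' : E × E → ℝ) (c : ℝ) (z : E × E) : Prop :=
  ∃ (hΛ : lamCone G z = lamCone G' z) (hN : nullCone k G z = nullCone k' G' z),
    weylSharp k' G' z = (umbralCongr hΛ hN).conj (weylSharp k G z) ∧
    (∀ X Y, umbralMetric k' G' z (umbralCongr hΛ hN X) (umbralCongr hΛ hN Y) =
      c * umbralMetric k G z X Y) ∧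
    (∀ X Y, weylForm k' G' z (umbralCongr hΛ hN X) (umbralCongr hΛ hN Y) =
      c * weylForm k G z X Y)

end Weyl

/-! ## Cone bundles on a manifold and their defining functions -/

section Manifold

variable {E : Type*} [NormedAddCommGroup E] [NormedSpace ℝ E]
variable {M : Type*} [TopologicalSpace M] [ChartedSpace E M] [IsManifold 𝓘(ℝ, E) ∞ M]

/-- An open subset of `TM' = TM \ 0` that is invariant under the scalings `(x, v) ↦ (x, t v)`,
`t > 0`. -/
structure IsConicOpen (U : Set (TangentBundle 𝓘(ℝ, E) M)) : Prop where
  isOpen : IsOpen U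
  ne_zero : ∀ q ∈ U, q.2 ≠ 0
  smul_mem : ∀ q ∈ U, ∀ t : ℝ, 0 < t → (⟨q.1, t • q.2⟩ : TangentBundle 𝓘(ℝ, E) M) ∈ U

/-- `f (x, t v) = t ^ k f (x, v)` for `(x, v) ∈ U` and `t > 0`. -/
def HomogeneousOn (U : Set (TangentBundle 𝓘(ℝ, E) M)) (k : ℝ)
    (f : TangentBundle 𝓘(ℝ, E) M → ℝ) : Prop :=
  ∀ q ∈ U, ∀ t : ℝ, 0 < t → f ⟨q.1, t • q.2⟩ = t ^ k * f q

/-- The restriction of `G` to the fibre `T_x M` (which is `E` as a vector space). -/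
def onFibre (G : TangentBundle 𝓘(ℝ, E) M → ℝ) (x : M) (w : E) : ℝ := G ⟨x, w⟩

/-- `G` is, over the conic open set `U ⊆ TM'`, a defining function of degree `k ≠ 1` of the cone
bundle `𝓗`: it is smooth and homogeneous on `U`, its zero set in `U` is `𝓗 ∩ U`, and at the points of
`𝓗 ∩ U` its fibre derivative `DG` is nonzero and its fibre Hessian is nondegenerate. -/
structure IsDefiningFunction (𝓗 U : Set (TangentBundle 𝓘(ℝ, E) M)) (k : ℝ)
    (G : TangentBundle 𝓘(ℝ, E) M → ℝ) : Prop where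
  conic : IsConicOpen U
  degree_ne_one : k ≠ 1
  smooth : ContMDiffOn 𝓘(ℝ, E).tangent 𝓘(ℝ, ℝ) ∞ G U
  homogeneous : HomogeneousOn U k G
  zero_iff : ∀ q ∈ U, G q = 0 ↔ q ∈ 𝓗
  fderiv_ne_zero : ∀ q ∈ 𝓗 ∩ U, fderiv ℝ (onFibre G q.1) q.2 ≠ 0
  hessian_nondegenerate : ∀ q ∈ 𝓗 ∩ U, ∀ u : E,
    (∀ w : E, fderiv ℝ (fderiv ℝ (onFibre G q.1)) q.2 u w = 0) → u = 0

/-- The coordinates `(φ (x), dφ_x (v))` of `(x, v) ∈ TM` in the chart of `TM` induced by a chart `φ`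
of `M`. -/
def chartPt (φ : OpenPartialHomeomorph M E) (q : TangentBundle 𝓘(ℝ, E) M) : E × E :=
  (φ q.1, mfderiv 𝓘(ℝ, E) 𝓘(ℝ, E) φ q.1 q.2)

/-- A function on `TM` in the coordinates induced by a chart `φ` of `M`. -/
def inChart (φ : OpenPartialHomeomorph M E) (G : TangentBundle 𝓘(ℝ, E) M → ℝ) (z : E × E) : ℝ :=
  G ⟨φ.symm z.1, mfderiv 𝓘(ℝ, E) 𝓘(ℝ, E) φ.symm z.1 z.2⟩

end Manifold

end CausalGeometry

/-! Everything is local, so the work is done in a chart of `TM`, where `V = (v, u)`. By Euler's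
identity, `V ⌟ dα = -(k - 1) dG` amounts to the Euler-Lagrange equations `D²G (V, (0, a)) = dG (a,
0)` (`spray_spec`), and `k ≠ 1` forces `V G = 0`. Linearising these equations (`jacobi`) shows that
the connection is compatible with `g` along `V` (`hessOne_eq`). Hence all vertical components drop
out of `S` (`tidal_apply`), and homogeneity then gives `S (V, ·) = 0`. The rest of part 1 is linear
algebra resting on `g (v, ·) = (k - 1) ∂G/∂v` (`fibreHess_euler`): on the kernel of `∂G/∂v` the
radical of `g` is exactly `⟨v⟩`.

Part 2 reduces to conformal changes. By Hadamard's lemma (`exists_factor`) two defining functions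
are related near a point of the cone by `Ĝ = J G` with `J` smooth, and `J` is nonzero and
homogeneous of degree `q`, the difference of the degrees (`euler_of_eq_mul`). On the cone `V̂ = V +
c C`, with `C` the Euler field and `c = -V(J) / ((k + q - 1) J)` (`spray_eq_shifted`). This identity
is available only on the cone, so it may be differentiated only in tangent directions. The
coordinate formula for `S` contains the derivative of `u` in a horizontal direction, which need not
be tangent; `tidal_diag` removes it by means of the linearised Euler-Lagrange equations. What is
left involves derivatives along `V` and along `(0, a)` with `∂G/∂v (a) = 0`, and all of these are
tangent.

Expanding by Leibniz and using the equation for `c` together with its vertical derivative gives `Ŝ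
(X, X) = J S (X, X) + κ g (X, X)` on `Λ`, with `κ` independent of `X` (`exists_tidal_diag`). Since
also `ĝ = J g` there, raising an index changes `S^♯` only by a multiple of the identity, which the
trace-free part does not see (`traceFree_of_equiv`). -/

namespace CausalGeometry

/-! ## Division of smooth functions -/

section Division

variable {F : Type*} [NormedAddCommGroup F] [NormedSpace ℝ F]

/-- The integral over `[0, 1]` of a smooth function of a parameter and of `t ∈ [-2, 2]` depends
smoothly on the parameter. -/
theorem contDiffOn_intervalIntegral_param {H : F → ℝ → ℝ} {s : Set F} (hs : IsOpen s)
    {O : Set (F × ℝ)} (hO : IsOpen O) (hH : ContDiffOn ℝ ∞ (fun q : F × ℝ => H q.1 q.2) O)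
    (hsO : ∀ p ∈ s, ∀ t ∈ Set.Icc (-2 : ℝ) 2, (p, t) ∈ O) :
    ContDiffOn ℝ ∞ (fun p => ∫ t in (0 : ℝ)..1, H p t) s := by
  -- The integral is the value at `0` of the convolution of the indicator of `(0, 1]` with `y ↦ χ
  -- (-y) H p (-y)`. The bump `χ`, which is `1` on the unit ball and `0` beyond radius `2`, supplies
  -- compact support without altering the integrand on `(0, 1]`.
  let χ : ContDiffBump (0 : ℝ) := ⟨1, 2, one_pos, by norm_num⟩
  let f : ℝ → ℝ := Set.indicator (Set.Ioc (0 : ℝ) 1) (fun _ => 1)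
  let g : F → ℝ → ℝ := fun p y => χ (-y) * H p (-y)
  have hf : MeasureTheory.LocallyIntegrable f MeasureTheory.volume := by
    refine MeasureTheory.Integrable.locallyIntegrable ?_
    rw [MeasureTheory.integrable_indicator_iff measurableSet_Ioc]
    simp
  have hgs : ∀ p, ∀ x, p ∈ s → x ∉ Metric.closedBall (0 : ℝ) 2 → g p x = 0 := by
    intro p x _ hx
    have : χ (-x) = 0 := by
      apply χ.zero_of_le_dist
      rw [Metric.mem_closedBall, dist_zero_right, not_le] at hx
      simpa using hx.le
    simp [g, this]
  have hg : ContDiffOn ℝ ∞ (fun q : F × ℝ => g q.1 q.2) (s ×ˢ Set.univ) := by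
    rintro ⟨p, y⟩ ⟨hp, -⟩
    apply ContDiffAt.contDiffWithinAt
    by_cases hy : y ∈ Set.Icc (-2 : ℝ) 2
    · have h1 : (p, -y) ∈ O := hsO p hp _ ⟨by linarith [hy.2], by linarith [hy.1]⟩
      have h2 : ContDiffAt ℝ ∞ (fun q : F × ℝ => H q.1 q.2) (p, -y) :=
        hH.contDiffAt (hO.mem_nhds h1)
      have h3 : ContDiffAt ℝ ∞ (fun q : F × ℝ => (q.1, -q.2)) (p, y) := by fun_prop
      have h4 : ContDiffAt ℝ ∞ (fun q : F × ℝ => H q.1 (-q.2)) (p, y) :=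
        ContDiffAt.comp (p, y) (g := fun q : F × ℝ => H q.1 q.2) h2 h3
      have h5 : ContDiffAt ℝ ∞ (fun q : F × ℝ => χ (-q.2)) (p, y) :=
        χ.contDiff.contDiffAt.comp (p, y) (by fun_prop)
      exact h5.mul h4
    · have hc : IsClosed {q : F × ℝ | q.2 ∈ Set.Icc (-2 : ℝ) 2} :=
        isClosed_Icc.preimage continuous_snd
      have : (fun q : F × ℝ => g q.1 q.2) =ᶠ[𝓝 (p, y)] fun _ => 0 := by
        filter_upwards [hc.isOpen_compl.mem_nhds (show (p, y) ∈ _ from hy)] with q hq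
        have : χ (-q.2) = 0 := by
          apply χ.zero_of_le_dist
          simp only [dist_zero_right, norm_neg, Real.norm_eq_abs]
          by_contra hlt
          exact hq (abs_le.1 (le_of_lt (not_le.1 hlt)))
        simp [g, this]
      exact contDiffAt_const.congr_of_eventuallyEq this
  have key := MeasureTheory.contDiffOn_convolution_right_with_param_comp (n := ⊤)
    (ContinuousLinearMap.mul ℝ ℝ) (μ := MeasureTheory.volume)
    (v := fun _ : F => (0 : ℝ)) contDiffOn_const hs
    (isCompact_closedBall (0 : ℝ) 2) hgs hf hg
  refine key.congr fun p hp => ?_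
  rw [MeasureTheory.convolution_def, intervalIntegral.integral_of_le zero_le_one,
    ← MeasureTheory.integral_indicator measurableSet_Ioc]
  congr 1
  ext t
  by_cases ht : t ∈ Set.Ioc (0 : ℝ) 1
  · have : χ t = 1 := χ.one_of_mem_closedBall (by
      simp only [Metric.mem_closedBall, dist_zero_right, Real.norm_eq_abs]
      exact abs_le.2 ⟨by linarith [ht.1], ht.2⟩)
    simp [f, g, ht, this]
  · simp [f, ht]

/-- A smooth function vanishing on the hyperplane `ℓ = 0` is, locally, smoothly divisible
by `ℓ`. -/
theorem exists_factor_of_linear {f : F → ℝ} {W : Set F} (hW : IsOpen W)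
    (hf : ContDiffOn ℝ ∞ f W) {y₀ : F} (hy₀ : y₀ ∈ W) (ℓ : F →L[ℝ] ℝ) {w : F} (hw : ℓ w = 1)
    (hℓ : ℓ y₀ = 0) (h0 : ∀ y ∈ W, ℓ y = 0 → f y = 0) :
    ∃ W' : Set F, IsOpen W' ∧ y₀ ∈ W' ∧ W' ⊆ W ∧ ∃ K : F → ℝ, ContDiffOn ℝ ∞ K W' ∧
      ∀ y ∈ W', f y = K y * ℓ y := by
  -- As `t` runs from `0` to `1`, `m (y, t)` moves from `y` along `w` to the hyperplane, where `f`
  -- vanishes. The fundamental theorem of calculus then gives `f y = ℓ y ∫₀¹ Df (m (y, t)) w dt`.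
  let m : F × ℝ → F := fun q => q.1 - (q.2 * ℓ q.1) • w
  have hm : ContDiff ℝ ∞ m := by fun_prop
  have hO : IsOpen (m ⁻¹' W) := hW.preimage hm.continuous
  -- Since `ℓ y₀ = 0`, the segment over `y₀` is a single point; compactness of `[-2, 2]` keeps
  -- nearby segments inside `W`.
  have hev : ∀ᶠ y in 𝓝 y₀, ∀ t ∈ Set.Icc (-2 : ℝ) 2, (y, t) ∈ m ⁻¹' W := by
    refine isCompact_Icc.eventually_forall_of_forall_eventually fun t _ => ?_
    refine hO.mem_nhds ?_
    simpa [m, hℓ] using hy₀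
  obtain ⟨W', hW'sub, hW', hy₀'⟩ := mem_nhds_iff.1 hev
  have hsub : W' ⊆ W := fun y hy => by
    simpa [m] using hW'sub hy 0 (by norm_num)
  refine ⟨W', hW', hy₀', hsub, fun y => ∫ t in (0 : ℝ)..1, fderiv ℝ f (m (y, t)) w, ?_, ?_⟩
  · refine contDiffOn_intervalIntegral_param hW' hO ?_ hW'sub
    have h1 : ContDiffOn ℝ ∞ (fderiv ℝ f) W := hf.fderiv_of_isOpen hW (by simp)
    exact (h1.comp hm.contDiffOn (fun _ h => h)).clm_apply contDiffOn_const
  · intro y hy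
    have hd : ∀ t ∈ Set.uIcc (0 : ℝ) 1,
        HasDerivAt (fun t => f (m (y, t))) (-(ℓ y) * fderiv ℝ f (m (y, t)) w) t := by
      intro t ht
      rw [Set.uIcc_of_le zero_le_one] at ht
      have hmem : m (y, t) ∈ W := hW'sub hy t ⟨by linarith [ht.1], by linarith [ht.2]⟩
      have h1 : HasFDerivAt f (fderiv ℝ f (m (y, t))) (m (y, t)) :=
        ((hf.contDiffAt (hW.mem_nhds hmem)).differentiableAt (by simp)).hasFDerivAt
      have h2 : HasDerivAt (fun t : ℝ => m (y, t)) (-((1 * ℓ y) • w)) t :=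
        (((hasDerivAt_id t).mul_const (ℓ y)).smul_const w).const_sub y
      have := HasFDerivAt.comp_hasDerivAt t h1 h2
      refine this.congr_deriv ?_
      simp
    have hcont : ContinuousOn (fun t : ℝ => -(ℓ y) * fderiv ℝ f (m (y, t)) w)
        (Set.uIcc (0 : ℝ) 1) := by
      rw [Set.uIcc_of_le zero_le_one]
      have h1 : ContinuousOn (fderiv ℝ f) W :=
        (hf.fderiv_of_isOpen hW (m := 0) (by simp)).continuousOn
      have h2 : ContinuousOn (fun t : ℝ => fderiv ℝ f (m (y, t))) (Set.Icc 0 1) :=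
        h1.comp (by fun_prop) fun t ht =>
          hW'sub hy t ⟨by linarith [ht.1], by linarith [ht.2]⟩
      fun_prop
    have hint := intervalIntegral.integral_eq_sub_of_hasDerivAt hd hcont.intervalIntegrable
    have h1 : f (m (y, 1)) = 0 := h0 _ (hW'sub hy 1 (by norm_num)) (by simp [m, hw])
    have h2 : m (y, 0) = y := by simp [m]
    rw [intervalIntegral.integral_const_mul, h1, h2] at hint
    linarith

/-- If `f` vanishes on the smooth hypersurface `G = 0` then, locally, it is smoothly divisible
by `G`. -/
theorem exists_factor [CompleteSpace F] {f G : F → ℝ} {W : Set F} (hW : IsOpen W)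
    (hf : ContDiffOn ℝ ∞ f W) (hG : ContDiffOn ℝ ∞ G W) {z₀ : F} (hz₀ : z₀ ∈ W)
    (hG0 : G z₀ = 0) (hdG : fderiv ℝ G z₀ ≠ 0) (h0 : ∀ z ∈ W, G z = 0 → f z = 0) :
    ∃ W' : Set F, IsOpen W' ∧ z₀ ∈ W' ∧ W' ⊆ W ∧ ∃ J : F → ℝ, ContDiffOn ℝ ∞ J W' ∧
      ∀ z ∈ W', f z = J z * G z := by
  obtain ⟨w₀, hw₀⟩ : ∃ w, fderiv ℝ G z₀ w ≠ 0 := by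
    by_contra! h
    exact hdG (ContinuousLinearMap.ext h)
  set ℓ := fderiv ℝ G z₀ with hℓ
  obtain ⟨w, hw⟩ : ∃ w, ℓ w = 1 := ⟨(ℓ w₀)⁻¹ • w₀, by simp [hw₀]⟩
  -- `Φ` straightens the hypersurface: `ℓ ∘ Φ = G` because `ℓ w = 1`, and its derivative at `z₀` is
  -- the identity, so the inverse function theorem reduces the claim to a hyperplane.
  let Φ : F → F := fun z => z - z₀ + (G z - ℓ (z - z₀)) • w
  have hΦ : ContDiffOn ℝ ∞ Φ W := by
    apply ContDiffOn.add (by fun_prop)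
    apply ContDiffOn.smul (hG.sub (by fun_prop)) contDiffOn_const
  have hℓΦ : ∀ z, ℓ (Φ z) = G z := fun z => by simp [Φ, hw]
  have hΦ0 : Φ z₀ = 0 := by simp [Φ, hG0]
  have hΦat := hΦ.contDiffAt (hW.mem_nhds hz₀)
  have hder : HasFDerivAt Φ ((ContinuousLinearEquiv.refl ℝ F : F ≃L[ℝ] F) : F →L[ℝ] F) z₀ := by
    have h1 : HasFDerivAt G ℓ z₀ :=
      ((hG.contDiffAt (hW.mem_nhds hz₀)).differentiableAt (by simp)).hasFDerivAt
    have h2 : HasFDerivAt (fun z => ℓ (z - z₀)) ℓ z₀ := by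
      simpa only [map_sub] using (ℓ.hasFDerivAt (x := z₀)).sub_const (ℓ z₀)
    have := ((hasFDerivAt_id (𝕜 := ℝ) z₀).sub_const z₀).add ((h1.sub h2).smul_const w)
    refine this.congr_fderiv ?_
    ext x
    simp
  have hne : (∞ : WithTop ℕ∞) ≠ 0 := by simp
  let Ψ := hΦat.toOpenPartialHomeomorph Φ hder hne
  have hΨ : ∀ z, Ψ z = Φ z := fun z => rfl
  have hsrc : z₀ ∈ Ψ.source := hΦat.mem_toOpenPartialHomeomorph_source hder hne
  -- points at which the derivative of `Φ` is invertible
  let D : Set F := {z | fderiv ℝ Φ z ∈ Set.range ((↑) : (F ≃L[ℝ] F) → F →L[ℝ] F)}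
  have hWD : IsOpen (W ∩ D) :=
    ((hΦ.fderiv_of_isOpen hW (m := 0) (by simp)).continuousOn).isOpen_inter_preimage hW
      ContinuousLinearEquiv.isOpen
  have hz₀D : z₀ ∈ W ∩ D := ⟨hz₀, ContinuousLinearEquiv.refl ℝ F, hder.fderiv.symm⟩
  let T : Set F := Ψ.target ∩ Ψ.symm ⁻¹' (W ∩ D)
  have hT : IsOpen T := Ψ.isOpen_inter_preimage_symm hWD
  have hsymm : ContDiffOn ℝ ∞ Ψ.symm T := by
    rintro y ⟨hy, hyW, e, he⟩
    have hat : ContDiffAt ℝ ∞ Φ (Ψ.symm y) := hΦ.contDiffAt (hW.mem_nhds hyW)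
    refine (Ψ.contDiffAt_symm (f₀' := e) hy ?_ hat).contDiffWithinAt
    rw [he]
    exact (hat.differentiableAt (by simp)).hasFDerivAt
  have h0T : (0 : F) ∈ T := by
    have h1 : Ψ z₀ = 0 := hΦ0
    have h2 : Ψ.symm 0 = z₀ := by rw [← h1, Ψ.left_inv hsrc]
    refine ⟨h1 ▸ Ψ.map_source hsrc, ?_⟩
    rw [Set.mem_preimage, h2]
    exact hz₀D
  obtain ⟨T', hT', h0T', hT'T, K, hK, hfK⟩ :=
    exists_factor_of_linear hT (hf.comp hsymm fun y hy => hy.2.1) h0T ℓ hw (map_zero ℓ) (by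
      intro y hy hly
      refine h0 _ hy.2.1 ?_
      rw [← hℓΦ, ← hΨ, Ψ.right_inv hy.1, hly])
  have hO : IsOpen (W ∩ Φ ⁻¹' T') := hΦ.continuousOn.isOpen_inter_preimage hW hT'
  refine ⟨Ψ.source ∩ (W ∩ Φ ⁻¹' T'), Ψ.open_source.inter hO, ⟨hsrc, hz₀, ?_⟩, fun z hz => hz.2.1,
    fun z => K (Φ z), hK.comp (hΦ.mono fun z hz => hz.2.1) fun z hz => hz.2.2, ?_⟩
  · rw [Set.mem_preimage, hΦ0]
    exact h0T'
  · rintro z ⟨hzs, hzW, hzT⟩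
    have := hfK _ hzT
    rw [hℓΦ, Function.comp_apply, ← hΨ, Ψ.left_inv hzs] at this
    exact this

end Division

/-- The derivative of a function vanishing on the hypersurface `G = 0` annihilates its tangent
space. -/
theorem fderiv_apply_eq_zero_of_eqOn {F : Type*} [NormedAddCommGroup F] [NormedSpace ℝ F]
    [CompleteSpace F] {f G : F → ℝ} {z : F} (hf : ContDiffAt ℝ ∞ f z) (hG : ContDiffAt ℝ ∞ G z)
    (hG0 : G z = 0) (hdG : fderiv ℝ G z ≠ 0) (h0 : ∀ᶠ y in 𝓝 z, G y = 0 → f y = 0)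
    {X : F} (hX : fderiv ℝ G z X = 0) : fderiv ℝ f z X = 0 := by
  -- Being constant on the level set, `f` has a constrained extremum at `z`, so Lagrange multipliers
  -- apply. The multiplier of `f` cannot vanish because `dG ≠ 0`.
  have hext : IsLocalExtrOn f {x | G x = G z} z := by
    refine Or.inl ?_
    refine eventually_nhdsWithin_iff.2 ?_
    filter_upwards [h0] with y hy hyG
    rw [hy (hyG.trans hG0), h0.self_of_nhds hG0]
  obtain ⟨Λ, Λ₀, hne, h⟩ := hext.exists_linear_map_of_hasStrictFDerivAt
    (hG.hasStrictFDerivAt (by simp)) (hf.hasStrictFDerivAt (by simp))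
  have hΛ₀ : Λ₀ ≠ 0 := by
    rintro rfl
    refine hne (Prod.ext ?_ rfl)
    obtain ⟨w, hw⟩ : ∃ w, fderiv ℝ G z w ≠ 0 := by
      by_contra! h'
      exact hdG (ContinuousLinearMap.ext h')
    ext
    have h1 := h w
    rw [zero_smul, add_zero, ← mul_one (fderiv ℝ G z w), ← smul_eq_mul, map_smul] at h1
    simpa [hw] using h1
  have h1 := h X
  rw [hX, map_zero, zero_add, smul_eq_mul] at h1
  exact (mul_eq_zero.1 h1).resolve_left hΛ₀

/-! ## Derivatives along vector fields -/

section LieD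

variable {F : Type*} [NormedAddCommGroup F] [NormedSpace ℝ F]
variable {H : Type*} [NormedAddCommGroup H] [NormedSpace ℝ H]
variable {H' : Type*} [NormedAddCommGroup H'] [NormedSpace ℝ H']

/-- The derivative of a function along a vector field. -/
def lieD (X : F → F) (f : F → H) (z : F) : H := fderiv ℝ f z (X z)

theorem _root_.ContDiffOn.differentiableAt_of_isOpen {f : F → H} {W : Set F} (hf : ContDiffOn ℝ ∞ f W)
    (hW : IsOpen W) {z : F} (hz : z ∈ W) : DifferentiableAt ℝ f z :=
  (hf.contDiffAt (hW.mem_nhds hz)).differentiableAt (by simp)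

theorem contDiffOn_fderiv {f : F → H} {W : Set F} (hf : ContDiffOn ℝ ∞ f W) (hW : IsOpen W) :
    ContDiffOn ℝ ∞ (fderiv ℝ f) W :=
  hf.fderiv_of_isOpen hW (by simp)

theorem contDiffOn_lieD {X : F → F} {f : F → H} {W : Set F} (hW : IsOpen W)
    (hX : ContDiffOn ℝ ∞ X W) (hf : ContDiffOn ℝ ∞ f W) : ContDiffOn ℝ ∞ (lieD X f) W :=
  (contDiffOn_fderiv hf hW).clm_apply hX

theorem lieD_congr {X : F → F} {f g : F → H} {W : Set F} (hW : IsOpen W)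
    (h : ∀ z ∈ W, f z = g z) {z : F} (hz : z ∈ W) : lieD X f z = lieD X g z := by
  have : f =ᶠ[𝓝 z] g := Filter.eventuallyEq_of_mem (hW.mem_nhds hz) h
  rw [lieD, lieD, this.fderiv_eq]

theorem lieD_add {X : F → F} {f g : F → H} {z : F} (hf : DifferentiableAt ℝ f z)
    (hg : DifferentiableAt ℝ g z) :
    lieD X (fun y => f y + g y) z = lieD X f z + lieD X g z := by
  simp only [lieD]
  rw [fderiv_fun_add hf hg]
  rfl

theorem lieD_sub {X : F → F} {f g : F → H} {z : F} (hf : DifferentiableAt ℝ f z)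
    (hg : DifferentiableAt ℝ g z) :
    lieD X (fun y => f y - g y) z = lieD X f z - lieD X g z := by
  simp only [lieD]
  rw [fderiv_fun_sub hf hg]
  rfl

theorem lieD_smul {X : F → F} {f : F → ℝ} {g : F → H} {z : F} (hf : DifferentiableAt ℝ f z)
    (hg : DifferentiableAt ℝ g z) :
    lieD X (fun y => f y • g y) z = f z • lieD X g z + lieD X f z • g z := by
  simp only [lieD]
  rw [fderiv_fun_smul hf hg]
  rfl

theorem lieD_mul {X : F → F} {f g : F → ℝ} {z : F} (hf : DifferentiableAt ℝ f z)
    (hg : DifferentiableAt ℝ g z) :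
    lieD X (fun y => f y * g y) z = f z * lieD X g z + lieD X f z * g z :=
  lieD_smul hf hg

theorem lieD_const_mul {X : F → F} (c : ℝ) {g : F → ℝ} {z : F}
    (hg : DifferentiableAt ℝ g z) :
    lieD X (fun y => c * g y) z = c * lieD X g z := by
  simp only [lieD]
  rw [fderiv_const_mul hg]
  rfl

theorem lieD_clm_apply {X : F → F} {B : F → H →L[ℝ] H'} {a : F → H} {z : F}
    (hB : DifferentiableAt ℝ B z) (ha : DifferentiableAt ℝ a z) :
    lieD X (fun y => B y (a y)) z = lieD X B z (a z) + B z (lieD X a z) := by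
  simp only [lieD]
  rw [fderiv_clm_apply hB ha]
  simp [add_comm]

theorem lieD_clm_apply_const {X : F → F} {B : F → H →L[ℝ] H'} (a : H) {z : F}
    (hB : DifferentiableAt ℝ B z) :
    lieD X (fun y => B y a) z = lieD X B z a := by
  rw [lieD_clm_apply hB (differentiableAt_const a)]
  simp [lieD]

theorem lieD_clm_apply₂_const {H'' : Type*} [NormedAddCommGroup H''] [NormedSpace ℝ H'']
    {X : F → F} {B : F → H →L[ℝ] H' →L[ℝ] H''} (a : H) (b : H') {z : F}
    (hB : DifferentiableAt ℝ B z) :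
    lieD X (fun y => B y a b) z = lieD X B z a b := by
  rw [lieD_clm_apply_const (B := fun y => B y a) b (hB.clm_apply (differentiableAt_const a)),
    lieD_clm_apply_const a hB]

/-- The commutator of two derivatives along vector fields. -/
theorem lieD_lieD {X Y : F → F} {f : F → H} {W : Set F} (hW : IsOpen W)
    (hf : ContDiffOn ℝ ∞ f W) (hX : ContDiffOn ℝ ∞ X W) (hY : ContDiffOn ℝ ∞ Y W)
    {z : F} (hz : z ∈ W) :
    lieD X (lieD Y f) z + fderiv ℝ f z (lieD Y X z) =
      lieD Y (lieD X f) z + fderiv ℝ f z (lieD X Y z) := by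
  have h1 := (contDiffOn_fderiv hf hW).differentiableAt_of_isOpen hW hz
  have hX1 := hX.differentiableAt_of_isOpen hW hz
  have hY1 := hY.differentiableAt_of_isOpen hW hz
  have hs : IsSymmSndFDerivAt ℝ f z :=
    (hf.contDiffAt (hW.mem_nhds hz)).isSymmSndFDerivAt
      (by rw [minSmoothness_of_isRCLikeNormedField]; exact WithTop.coe_le_coe.2 le_top)
  have e1 : lieD X (lieD Y f) z = fderiv ℝ (fderiv ℝ f) z (X z) (Y z) +
      fderiv ℝ f z (lieD X Y z) := lieD_clm_apply h1 hY1
  have e2 : lieD Y (lieD X f) z = fderiv ℝ (fderiv ℝ f) z (Y z) (X z) +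
      fderiv ℝ f z (lieD Y X z) := lieD_clm_apply h1 hX1
  rw [e1, e2, hs (X z) (Y z)]
  abel

theorem contDiffOn_flip {n : WithTop ℕ∞} {H'' : Type*} [NormedAddCommGroup H'']
    [NormedSpace ℝ H''] {B : F → H →L[ℝ] H' →L[ℝ] H''} {W : Set F} (hB : ContDiffOn ℝ n B W) :
    ContDiffOn ℝ n (fun z => (B z).flip) W :=
  have hc : ContDiff ℝ n
      (ContinuousLinearMap.flip : (H →L[ℝ] H' →L[ℝ] H'') → (H' →L[ℝ] H →L[ℝ] H'')) :=
    IsBoundedLinearMap.contDiff ⟨⟨fun _ _ => rfl, fun _ _ => rfl⟩, 1, one_pos, fun B => by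
      rw [one_mul, ContinuousLinearMap.opNorm_flip]⟩
  hc.comp_contDiffOn hB

theorem contDiffOn_bilinearComp {n : WithTop ℕ∞} {K K' : Type*} [NormedAddCommGroup K]
    [NormedSpace ℝ K] [NormedAddCommGroup K'] [NormedSpace ℝ K'] {B : F → H →L[ℝ] H' →L[ℝ] ℝ}
    {A : F → K →L[ℝ] H} {A' : F → K' →L[ℝ] H'} {W : Set F} (hB : ContDiffOn ℝ n B W)
    (hA : ContDiffOn ℝ n A W) (hA' : ContDiffOn ℝ n A' W) :
    ContDiffOn ℝ n (fun z => (B z).bilinearComp (A z) (A' z)) W :=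
  contDiffOn_flip ((contDiffOn_flip (hB.clm_comp hA)).clm_comp hA')

theorem lieForm_apply (V : F → F) (B : F → F →L[ℝ] F →L[ℝ] ℝ) (z X Y : F) :
    lieForm V B z X Y = lieD V B z X Y + B z (fderiv ℝ V z X) Y + B z X (fderiv ℝ V z Y) := rfl

theorem contDiffOn_lieForm {V : F → F} {B : F → F →L[ℝ] F →L[ℝ] ℝ} {W : Set F} (hW : IsOpen W)
    (hV : ContDiffOn ℝ ∞ V W) (hB : ContDiffOn ℝ ∞ B W) : ContDiffOn ℝ ∞ (lieForm V B) W :=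
  ((contDiffOn_lieD hW hV hB).add
    (contDiffOn_bilinearComp hB (contDiffOn_fderiv hV hW) contDiffOn_const)).add
    (contDiffOn_bilinearComp hB contDiffOn_const (contDiffOn_fderiv hV hW))

end LieD

/-! ## The dynamical vector field near a point of the cone -/

section Spray

variable {E : Type*} [NormedAddCommGroup E] [NormedSpace ℝ E]

/-- `G` is, on an open subset `W` of a chart of the tangent bundle, smooth, homogeneous of degree
`k ≠ 1` in the infinitesimal sense, and its fibre Hessian is nondegenerate. -/
structure IsLocalDefining (k : ℝ) (G : E × E → ℝ) (W : Set (E × E)) : Prop where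
  isOpen : IsOpen W
  ne_one : k ≠ 1
  smooth : ContDiffOn ℝ ∞ G W
  euler : ∀ z ∈ W, fderiv ℝ G z (0, z.2) = k * G z
  nondeg : ∀ z ∈ W, ∀ u : E, (∀ w : E, fibreHess G z u w = 0) → u = 0

theorem IsLocalDefining.mono {k : ℝ} {G : E × E → ℝ} {W W' : Set (E × E)}
    (h : IsLocalDefining k G W) (hW' : IsOpen W') (hsub : W' ⊆ W) : IsLocalDefining k G W' :=
  ⟨hW', h.ne_one, h.smooth.mono hsub, fun z hz => h.euler z (hsub hz),
    fun z hz => h.nondeg z (hsub hz)⟩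

theorem fibreHess_apply (G : E × E → ℝ) (z : E × E) (a b : E) :
    fibreHess G z a b = fderiv ℝ (fderiv ℝ G) z (0, a) (0, b) := rfl

theorem map_mk_zero_zero {H : Type*} [AddCommGroup H] [Module ℝ H] [TopologicalSpace H]
    (f : E × E →L[ℝ] H) : f (0, 0) = 0 :=
  map_zero f

variable {k : ℝ} {G : E × E → ℝ} {W : Set (E × E)} {z : E × E}

/-- The derivative of the Euler identity. -/
theorem fderiv_euler (hW : IsOpen W) (hG : ContDiffOn ℝ ∞ G W)
    (he : ∀ z ∈ W, fderiv ℝ G z (0, z.2) = k * G z) (hz : z ∈ W) (Y : E × E) :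
    fderiv ℝ (fderiv ℝ G) z Y (0, z.2) + fderiv ℝ G z (0, Y.2) = k * fderiv ℝ G z Y := by
  have h1 : lieD (fun _ => Y) (fun y : E × E => fderiv ℝ G y (0, y.2)) z =
      lieD (fun _ => Y) (fun y => k * G y) z := lieD_congr hW he hz
  have hc : HasFDerivAt (fun y : E × E => ((0 : E), y.2))
      ((0 : E × E →L[ℝ] E).prod (ContinuousLinearMap.snd ℝ E E)) z :=
    (hasFDerivAt_const (0 : E) z).prodMk hasFDerivAt_snd
  rw [lieD_const_mul _ (hG.differentiableAt_of_isOpen hW hz),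
    lieD_clm_apply ((contDiffOn_fderiv hG hW).differentiableAt_of_isOpen hW hz)
      hc.differentiableAt] at h1
  have h2 : lieD (fun _ => Y) (fun y : E × E => ((0 : E), y.2)) z = (0, Y.2) := by
    simp [lieD, hc.fderiv]
  rw [h2] at h1
  exact h1

namespace IsLocalDefining

theorem contDiffOn_fderiv (h : IsLocalDefining k G W) : ContDiffOn ℝ ∞ (fderiv ℝ G) W :=
  CausalGeometry.contDiffOn_fderiv h.smooth h.isOpen

theorem contDiffOn_snd (h : IsLocalDefining k G W) :
    ContDiffOn ℝ ∞ (fderiv ℝ (fderiv ℝ G)) W :=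
  CausalGeometry.contDiffOn_fderiv h.contDiffOn_fderiv h.isOpen

theorem symm (h : IsLocalDefining k G W) (hz : z ∈ W) (X Y : E × E) :
    fderiv ℝ (fderiv ℝ G) z X Y = fderiv ℝ (fderiv ℝ G) z Y X :=
  (h.smooth.contDiffAt (h.isOpen.mem_nhds hz)).isSymmSndFDerivAt
    (by rw [minSmoothness_of_isRCLikeNormedField]; exact WithTop.coe_le_coe.2 le_top) X Y

theorem fibreHess_symm (h : IsLocalDefining k G W) (hz : z ∈ W) (a b : E) :
    fibreHess G z a b = fibreHess G z b a :=
  h.symm hz _ _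

theorem fderiv_contactForm (h : IsLocalDefining k G W) (hz : z ∈ W) (X Y : E × E) :
    fderiv ℝ (contactForm G) z X Y = fderiv ℝ (fderiv ℝ G) z X (0, Y.1) := by
  have h1 : DifferentiableAt ℝ (fderiv ℝ G) z :=
    h.contDiffOn_fderiv.differentiableAt_of_isOpen h.isOpen hz
  have h2 : HasFDerivAt (contactForm G) _ z :=
    h1.hasFDerivAt.clm_comp (hasFDerivAt_const (vertEnd (E := E)) z)
  rw [h2.fderiv]
  simp [vertEnd]

theorem dContact_apply (h : IsLocalDefining k G W) (hz : z ∈ W) (X Y : E × E) :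
    dContact G z X Y = fderiv ℝ (fderiv ℝ G) z X (0, Y.1) -
      fderiv ℝ (fderiv ℝ G) z Y (0, X.1) := by
  rw [← h.fderiv_contactForm hz, ← h.fderiv_contactForm hz]
  rfl

/-- The derivative of the Euler identity. -/
theorem euler_snd (h : IsLocalDefining k G W) (hz : z ∈ W) (Y : E × E) :
    fderiv ℝ (fderiv ℝ G) z Y (0, z.2) + fderiv ℝ G z (0, Y.2) = k * fderiv ℝ G z Y :=
  fderiv_euler h.isOpen h.smooth h.euler hz Y

/-- Since `k ≠ 1`, this makes the kernel of `∂G/∂v` the `g`-orthogonal complement of `v`; the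
structure of the umbral space rests on it. -/
theorem fibreHess_euler (h : IsLocalDefining k G W) (hz : z ∈ W) (a : E) :
    fibreHess G z z.2 a = (k - 1) * fderiv ℝ G z (0, a) := by
  have := h.euler_snd hz (0, a)
  rw [h.fibreHess_symm hz, fibreHess_apply]
  linear_combination this

theorem snd_euler_hor (h : IsLocalDefining k G W) (hz : z ∈ W) (a : E) :
    fderiv ℝ (fderiv ℝ G) z (0, z.2) (a, 0) = k * fderiv ℝ G z (a, 0) := by
  have := h.euler_snd hz (a, 0)
  rw [h.symm hz]
  simpa [map_mk_zero_zero] using this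

variable [FiniteDimensional ℝ E]

theorem exists_fibreHess_eq (h : IsLocalDefining k G W) (hz : z ∈ W) (β : E →L[ℝ] ℝ) :
    ∃ u, ∀ a, fibreHess G z u a = β a := by
  let f : E →ₗ[ℝ] (E →L[ℝ] ℝ) := (fibreHess G z).toLinearMap
  have hinj : Function.Injective f := by
    rw [← LinearMap.ker_eq_bot, LinearMap.ker_eq_bot']
    intro u hu
    exact h.nondeg z hz u fun w => DFunLike.congr_fun hu w
  have hdim : Module.finrank ℝ E = Module.finrank ℝ (E →L[ℝ] ℝ) := by
    rw [← (LinearMap.toContinuousLinearMap (𝕜 := ℝ) (E := E) (F' := ℝ)).finrank_eq,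
      Subspace.dual_finrank_eq]
  obtain ⟨u, hu⟩ := (LinearMap.injective_iff_surjective_of_finrank_eq_finrank hdim).1 hinj β
  exact ⟨u, fun a => DFunLike.congr_fun hu a⟩

/-- Testing `dα (X, ·) = 0` on vertical vectors gives `g (ξ, ·) = 0`, then on horizontal ones `g (ν,
·) = 0`; equal dimensions do the rest. Thus the `inverse` in `spray` is a genuine inverse here. -/
theorem exists_equiv_dContact (h : IsLocalDefining k G W) (hz : z ∈ W) :
    ∃ e : (E × E) ≃L[ℝ] (E × E →L[ℝ] ℝ), (e : E × E →L[ℝ] E × E →L[ℝ] ℝ) = dContact G z := by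
  have hinj : Function.Injective (dContact G z).toLinearMap := by
    rw [← LinearMap.ker_eq_bot, LinearMap.ker_eq_bot']
    rintro ⟨ξ, ν⟩ hX
    have h0 : ∀ Y, dContact G z (ξ, ν) Y = 0 := fun Y => DFunLike.congr_fun hX Y
    simp only [h.dContact_apply hz] at h0
    have h1 : ξ = 0 := by
      refine h.nondeg z hz ξ fun w => ?_
      have := h0 (0, w)
      rw [h.fibreHess_symm hz, fibreHess_apply]
      simpa [map_mk_zero_zero] using this
    subst h1
    have h2 : ν = 0 := by
      refine h.nondeg z hz ν fun w => ?_
      have := h0 (w, 0)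
      rw [fibreHess_apply]
      simpa [map_mk_zero_zero] using this
    rw [h2]
    rfl
  have hdim : Module.finrank ℝ (E × E) = Module.finrank ℝ (E × E →L[ℝ] ℝ) := by
    rw [← (LinearMap.toContinuousLinearMap (𝕜 := ℝ) (E := E × E) (F' := ℝ)).finrank_eq,
      Subspace.dual_finrank_eq]
  let e := LinearEquiv.ofInjectiveOfFinrankEq (dContact G z).toLinearMap hinj hdim
  exact ⟨e.toContinuousLinearEquiv, rfl⟩

/-- The derivative of the Euler identity turns `-(k - 1) dG` into `dα ((v, u), ·)` once the
Euler-Lagrange equations hold, and invertibility of `dα` gives uniqueness. This criterion later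
identifies the dynamical field of `J G`. -/
theorem spray_eq (h : IsLocalDefining k G W) (hz : z ∈ W) {u : E}
    (hu : ∀ a, fderiv ℝ (fderiv ℝ G) z (z.2, u) (0, a) = fderiv ℝ G z (a, 0)) :
    spray k G z = (z.2, u) := by
  obtain ⟨e, he⟩ := h.exists_equiv_dContact hz
  have h1 : e (z.2, u) = (-(k - 1)) • fderiv ℝ G z := by
    refine ContinuousLinearMap.ext fun Y => ?_
    have h2 : e (z.2, u) Y = dContact G z (z.2, u) Y := by rw [← he]; rfl
    rw [h2, h.dContact_apply hz, hu]
    have h3 := h.euler_snd hz Y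
    have h4 : fderiv ℝ G z Y = fderiv ℝ G z (Y.1, 0) + fderiv ℝ G z (0, Y.2) := by
      rw [← map_add]; simp
    simp only [smul_apply, smul_eq_mul]
    linear_combination -h4 - h3
  rw [spray, ← he, ContinuousLinearMap.inverse_equiv, ContinuousLinearEquiv.coe_coe,
    ← map_smul, ← h1, e.symm_apply_apply]

/-- The Euler-Lagrange equations. -/
theorem spray_spec (h : IsLocalDefining k G W) (hz : z ∈ W) :
    (spray k G z).1 = z.2 ∧
      ∀ a, fderiv ℝ (fderiv ℝ G) z (spray k G z) (0, a) = fderiv ℝ G z (a, 0) := by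
  obtain ⟨u, hu⟩ := h.exists_fibreHess_eq hz
    ((fderiv ℝ G z).comp (ContinuousLinearMap.inl ℝ E E) -
      (fderiv ℝ (fderiv ℝ G) z (z.2, 0)).comp (ContinuousLinearMap.inr ℝ E E))
  have hu' : ∀ a, fderiv ℝ (fderiv ℝ G) z (z.2, u) (0, a) = fderiv ℝ G z (a, 0) := by
    intro a
    have h1 := hu a
    rw [fibreHess_apply] at h1
    have h2 : ((z.2, u) : E × E) = (z.2, 0) + (0, u) := by simp
    rw [h2, map_add, add_apply, h1]
    simp
  rw [h.spray_eq hz hu']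
  exact ⟨rfl, hu'⟩

theorem spray_fst (h : IsLocalDefining k G W) (hz : z ∈ W) : (spray k G z).1 = z.2 :=
  (h.spray_spec hz).1

theorem euler_lagrange (h : IsLocalDefining k G W) (hz : z ∈ W) (a : E) :
    fderiv ℝ (fderiv ℝ G) z (spray k G z) (0, a) = fderiv ℝ G z (a, 0) :=
  (h.spray_spec hz).2 a

/-- Inversion of continuous linear maps is smooth at invertible ones, and `dα` is invertible on `W`.
-/
theorem contDiffOn_spray (h : IsLocalDefining k G W) : ContDiffOn ℝ ∞ (spray k G) W := by
  have hα : ContDiffOn ℝ ∞ (contactForm G) W := h.contDiffOn_fderiv.clm_comp contDiffOn_const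
  have hdα := CausalGeometry.contDiffOn_fderiv hα h.isOpen
  have hd : ContDiffOn ℝ ∞ (dContact G) W := hdα.sub (contDiffOn_flip hdα)
  intro z hz
  obtain ⟨e, he⟩ := h.exists_equiv_dContact hz
  have h1 : ContDiffAt ℝ ∞ ContinuousLinearMap.inverse (dContact G z) := by
    rw [← he]
    exact contDiffAt_map_inverse e
  have h2 : ContDiffWithinAt ℝ ∞ (fun y => (dContact G y).inverse) W z :=
    h1.comp_contDiffWithinAt z (hd z hz)
  exact (h2.clm_apply (h.contDiffOn_fderiv z hz)).const_smul (-(k - 1))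

/-- `V G = 0`. -/
theorem fderiv_spray (h : IsLocalDefining k G W) (hz : z ∈ W) :
    fderiv ℝ G z (spray k G z) = 0 := by
  -- The Euler identity differentiated along `V`, combined with the Euler-Lagrange equation for `a =
  -- v`, reads `dG (V) = k dG (V)`.
  have h1 := h.euler_snd hz (spray k G z)
  have h2 := h.euler_lagrange hz z.2
  have h3 : fderiv ℝ G z (spray k G z) = fderiv ℝ G z (z.2, 0) +
      fderiv ℝ G z (0, (spray k G z).2) := by
    rw [← map_add, ← h.spray_fst hz]; simp
  rw [h2] at h1
  have h4 : (k - 1) * fderiv ℝ G z (spray k G z) = 0 := by linear_combination -h1 - h3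
  exact (mul_eq_zero.1 h4).resolve_left (sub_ne_zero.2 h.ne_one)

end IsLocalDefining

end Spray

/-! ## The tidal force tensor in coordinates -/

section Tidal

variable {E : Type*} [NormedAddCommGroup E] [NormedSpace ℝ E]

/-- The derivative of the acceleration `u` of the dynamical vector field `V = (v, u)` in a
horizontal coordinate direction. -/
def accHor (k : ℝ) (G : E × E → ℝ) (z : E × E) (a : E) : E := (fderiv ℝ (spray k G) z (a, 0)).2

/-- The derivative of the acceleration `u` of the dynamical vector field `V = (v, u)` in a
vertical direction. -/
def accVert (k : ℝ) (G : E × E → ℝ) (z : E × E) (a : E) : E := (fderiv ℝ (spray k G) z (0, a)).2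

/-- The derivative of the fibre Hessian along the dynamical vector field. -/
def hessOne (k : ℝ) (G : E × E → ℝ) : E × E → E →L[ℝ] E →L[ℝ] ℝ :=
  lieD (spray k G) (fibreHess G)

/-- The second derivative of the fibre Hessian along the dynamical vector field. -/
def hessTwo (k : ℝ) (G : E × E → ℝ) : E × E → E →L[ℝ] E →L[ℝ] ℝ :=
  lieD (spray k G) (hessOne k G)

variable {k : ℝ} {G : E × E → ℝ} {W : Set (E × E)} {z : E × E}

theorem fderiv_spray_snd (k : ℝ) (G : E × E → ℝ) (z : E × E) (X : E × E) :
    (fderiv ℝ (spray k G) z X).2 = accHor k G z X.1 + accVert k G z X.2 := by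
  have : X = (X.1, 0) + (0, X.2) := by simp
  conv_lhs => rw [this, map_add]
  rfl

theorem lieD_snd (k : ℝ) (G : E × E → ℝ) (z : E × E) :
    lieD (spray k G) (fun y : E × E => y.2) z = (spray k G z).2 := by
  have h3 : HasFDerivAt (fun y : E × E => y.2) (ContinuousLinearMap.snd ℝ E E) z :=
    hasFDerivAt_snd
  rw [lieD, h3.fderiv]
  rfl

namespace IsLocalDefining

theorem contDiffOn_fibreHess (h : IsLocalDefining k G W) : ContDiffOn ℝ ∞ (fibreHess G) W :=
  contDiffOn_bilinearComp h.contDiffOn_snd contDiffOn_const contDiffOn_const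

theorem lieD_fderiv_apply (h : IsLocalDefining k G W) (hz : z ∈ W) (X : E × E → E × E)
    (e : E × E) :
    lieD X (fun y => fderiv ℝ G y e) z = fderiv ℝ (fderiv ℝ G) z (X z) e :=
  lieD_clm_apply_const e (h.contDiffOn_fderiv.differentiableAt_of_isOpen h.isOpen hz)

theorem lieD_fibreHess_apply (h : IsLocalDefining k G W) (hz : z ∈ W) (a b : E) :
    lieD (spray k G) (fun y => fibreHess G y a b) z = hessOne k G z a b :=
  lieD_clm_apply₂_const a b (h.contDiffOn_fibreHess.differentiableAt_of_isOpen h.isOpen hz)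

theorem hessOne_symm (h : IsLocalDefining k G W) (hz : z ∈ W) (a b : E) :
    hessOne k G z a b = hessOne k G z b a := by
  rw [← h.lieD_fibreHess_apply hz, ← h.lieD_fibreHess_apply hz]
  exact lieD_congr h.isOpen (fun y hy => h.fibreHess_symm hy a b) hz

variable [FiniteDimensional ℝ E]

theorem contDiffOn_hessOne (h : IsLocalDefining k G W) : ContDiffOn ℝ ∞ (hessOne k G) W :=
  contDiffOn_lieD h.isOpen h.contDiffOn_spray h.contDiffOn_fibreHess

theorem lieD_hessOne_apply (h : IsLocalDefining k G W) (hz : z ∈ W) (a b : E) :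
    lieD (spray k G) (fun y => hessOne k G y a b) z = hessTwo k G z a b :=
  lieD_clm_apply₂_const a b (h.contDiffOn_hessOne.differentiableAt_of_isOpen h.isOpen hz)

theorem hessTwo_symm (h : IsLocalDefining k G W) (hz : z ∈ W) (a b : E) :
    hessTwo k G z a b = hessTwo k G z b a := by
  rw [← h.lieD_hessOne_apply hz, ← h.lieD_hessOne_apply hz]
  exact lieD_congr h.isOpen (fun y hy => h.hessOne_symm hy a b) hz

theorem differentiableAt_spray (h : IsLocalDefining k G W) (hz : z ∈ W) :
    DifferentiableAt ℝ (spray k G) z :=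
  h.contDiffOn_spray.differentiableAt_of_isOpen h.isOpen hz

theorem fderiv_spray_fst (h : IsLocalDefining k G W) (hz : z ∈ W) (X : E × E) :
    (fderiv ℝ (spray k G) z X).1 = X.2 := by
  have h1 : lieD (fun _ => X) (fun y => (spray k G y).1) z =
      lieD (fun _ => X) (fun y : E × E => y.2) z :=
    lieD_congr h.isOpen (fun y hy => h.spray_fst hy) hz
  have h2 : HasFDerivAt (fun y => (spray k G y).1) _ z :=
    (h.differentiableAt_spray hz).hasFDerivAt.fst
  have h3 : HasFDerivAt (fun y : E × E => y.2) (ContinuousLinearMap.snd ℝ E E) z :=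
    hasFDerivAt_snd
  rw [lieD, lieD, h2.fderiv, h3.fderiv] at h1
  exact h1

theorem fderiv_spray_hor (h : IsLocalDefining k G W) (hz : z ∈ W) (a : E) :
    fderiv ℝ (spray k G) z (a, 0) = (0, accHor k G z a) :=
  Prod.ext (h.fderiv_spray_fst hz _) rfl

theorem fderiv_spray_vert (h : IsLocalDefining k G W) (hz : z ∈ W) (a : E) :
    fderiv ℝ (spray k G) z (0, a) = (a, accVert k G z a) :=
  Prod.ext (h.fderiv_spray_fst hz _) rfl

theorem spray_eq_mk (h : IsLocalDefining k G W) (hz : z ∈ W) :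
    spray k G z = (z.2, (spray k G z).2) :=
  Prod.ext (h.spray_fst hz) rfl

/-- The linearisation of the Euler-Lagrange equations. -/
theorem jacobi (h : IsLocalDefining k G W) (hz : z ∈ W) (X : E × E) (a : E) :
    lieD (spray k G) (fun y => fderiv ℝ (fderiv ℝ G) y X (0, a)) z +
      fderiv ℝ (fderiv ℝ G) z (fderiv ℝ (spray k G) z X) (0, a) =
      fderiv ℝ (fderiv ℝ G) z X (a, 0) := by
  -- The commutator of the constant field `X` with `V` is applied to `p = ∂G/∂v (a)`. The
  -- Euler-Lagrange equation `V p = ∂G/∂x (a)` holds on all of `W`, so it can be differentiated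
  -- along `X`.
  have hp : ContDiffOn ℝ ∞ (fun y => fderiv ℝ G y (0, a)) W :=
    h.contDiffOn_fderiv.clm_apply contDiffOn_const
  have h1 := lieD_lieD h.isOpen hp (contDiffOn_const (c := X)) h.contDiffOn_spray hz
  have h2 : lieD (fun _ => X) (lieD (spray k G) fun y => fderiv ℝ G y (0, a)) z =
      lieD (fun _ => X) (fun y => fderiv ℝ G y (a, 0)) z := by
    refine lieD_congr h.isOpen (fun y hy => ?_) hz
    rw [h.lieD_fderiv_apply hy, h.euler_lagrange hy]
  have h3 : lieD (spray k G) (lieD (fun _ => X) fun y => fderiv ℝ G y (0, a)) z =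
      lieD (spray k G) (fun y => fderiv ℝ (fderiv ℝ G) y X (0, a)) z :=
    lieD_congr h.isOpen (fun y hy => h.lieD_fderiv_apply hy _ _) hz
  have h4 : lieD (spray k G) (fun _ : E × E => X) z = 0 := by simp [lieD]
  have h5 : fderiv ℝ (fun y => fderiv ℝ G y (0, a)) z (lieD (fun _ => X) (spray k G) z) =
      fderiv ℝ (fderiv ℝ G) z (fderiv ℝ (spray k G) z X) (0, a) :=
    h.lieD_fderiv_apply hz (fun y => lieD (fun _ => X) (spray k G) y) _
  rw [h2, h3, h4, h5, h.lieD_fderiv_apply hz, map_zero, add_zero] at h1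
  exact h1.symm

/-- The mixed second derivatives enter antisymmetrically in `a` and `b`; symmetrising therefore
isolates `V(g)`, which is how `hessOne_eq` arises. -/
theorem jacobi_vert (h : IsLocalDefining k G W) (hz : z ∈ W) (b a : E) :
    hessOne k G z b a + fderiv ℝ (fderiv ℝ G) z (b, 0) (0, a) +
      fibreHess G z (accVert k G z b) a = fderiv ℝ (fderiv ℝ G) z (0, b) (a, 0) := by
  have h1 := h.jacobi hz (0, b) a
  rw [h.fderiv_spray_vert hz] at h1
  have h2 : ((b, accVert k G z b) : E × E) = (b, 0) + (0, accVert k G z b) := by simp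
  rw [h2, map_add, add_apply] at h1
  rw [← h.lieD_fibreHess_apply hz, fibreHess_apply, add_assoc]
  exact h1

/-- This trades the horizontal derivative of the acceleration for derivatives of `G`, as needed in
`tidal_diag`. -/
theorem jacobi_hor (h : IsLocalDefining k G W) (hz : z ∈ W) (b a : E) :
    lieD (spray k G) (fun y => fderiv ℝ (fderiv ℝ G) y (b, 0) (0, a)) z +
      fibreHess G z (accHor k G z b) a = fderiv ℝ (fderiv ℝ G) z (b, 0) (a, 0) := by
  have h1 := h.jacobi hz (b, 0) a
  rw [h.fderiv_spray_hor hz] at h1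
  exact h1

/-- The connection is compatible with the fibre Hessian along the dynamical vector field. -/
theorem hessOne_eq (h : IsLocalDefining k G W) (hz : z ∈ W) (a b : E) :
    hessOne k G z a b = -(1 / 2) * fibreHess G z (accVert k G z a) b -
      (1 / 2) * fibreHess G z a (accVert k G z b) := by
  have h1 := h.jacobi_vert hz a b
  have h2 := h.jacobi_vert hz b a
  rw [h.symm hz (0, a) (b, 0)] at h1
  rw [h.symm hz (0, b) (a, 0), h.hessOne_symm hz] at h2
  rw [h.fibreHess_symm hz a]
  linear_combination (1 / 2) * h1 + (1 / 2) * h2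

theorem hor_vert_euler (h : IsLocalDefining k G W) (hz : z ∈ W) (a : E) :
    fderiv ℝ (fderiv ℝ G) z (z.2, 0) (0, a) =
      fderiv ℝ G z (a, 0) - fibreHess G z (spray k G z).2 a := by
  have h1 := h.euler_lagrange hz a
  have h2 : spray k G z = (z.2, 0) + (0, (spray k G z).2) := by
    rw [← h.spray_fst hz]; simp
  rw [h2, map_add, add_apply] at h1
  rw [fibreHess_apply]
  linear_combination h1

/-- The derivative of `g (v, a) = (k - 1) ∂G/∂v (a)` along `V`. -/
theorem hessOne_euler (h : IsLocalDefining k G W) (hz : z ∈ W) (a : E) :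
    hessOne k G z z.2 a + fibreHess G z (spray k G z).2 a = (k - 1) * fderiv ℝ G z (a, 0) := by
  have h1 : lieD (spray k G) (fun y => fibreHess G y y.2 a) z =
      lieD (spray k G) (fun y => (k - 1) * fderiv ℝ G y (0, a)) z :=
    lieD_congr h.isOpen (fun y hy => h.fibreHess_euler hy a) hz
  have hΓ := h.contDiffOn_fibreHess.differentiableAt_of_isOpen h.isOpen hz
  have hG := h.contDiffOn_fderiv.differentiableAt_of_isOpen h.isOpen hz
  rw [lieD_const_mul _ (hG.clm_apply (differentiableAt_const _)), h.lieD_fderiv_apply hz,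
    h.euler_lagrange hz,
    lieD_clm_apply_const (B := fun y => fibreHess G y y.2) a
      (hΓ.clm_apply differentiableAt_snd),
    lieD_clm_apply hΓ differentiableAt_snd, lieD_snd] at h1
  exact h1

/-- The dynamical vector field is homogeneous of degree two. -/
theorem accVert_euler (h : IsLocalDefining k G W) (hz : z ∈ W) :
    accVert k G z z.2 = (2 : ℝ) • (spray k G z).2 := by
  rw [← sub_eq_zero]
  -- By nondegeneracy it suffices to pair with `a`. The result is the difference of the vertical
  -- Jacobi equation at `b = v` and the derivative along `V` of `g (v, a) = (k - 1) ∂G/∂v (a)`.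
  refine h.nondeg z hz _ fun a => ?_
  have h1 := h.jacobi_vert hz z.2 a
  rw [h.hor_vert_euler hz, h.snd_euler_hor hz] at h1
  have h2 := h.hessOne_euler hz a
  rw [map_sub, map_smul, sub_apply, smul_apply, smul_eq_mul]
  linear_combination h1 - h2

/-- The derivative of `∂G/∂x (a)` along `V`. -/
theorem lieD_hor (h : IsLocalDefining k G W) (hz : z ∈ W) (a : E) :
    fderiv ℝ (fderiv ℝ G) z (spray k G z) (a, 0) = -fderiv ℝ G z (0, accHor k G z a) := by
  have h1 : lieD (fun _ => (a, 0)) (fun y => fderiv ℝ G y (spray k G y)) z =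
      lieD (fun _ => (a, 0)) (fun _ => (0 : ℝ)) z :=
    lieD_congr h.isOpen (fun y hy => h.fderiv_spray hy) hz
  rw [lieD_clm_apply (h.contDiffOn_fderiv.differentiableAt_of_isOpen h.isOpen hz)
    (h.differentiableAt_spray hz)] at h1
  have h2 : lieD (fun _ => (a, 0)) (fun _ : E × E => (0 : ℝ)) z = 0 := by simp [lieD]
  have h3 : lieD (fun _ => (a, 0)) (fderiv ℝ G) z = fderiv ℝ (fderiv ℝ G) z (a, 0) := rfl
  have h4 : lieD (fun _ => (a, 0)) (spray k G) z = (0, accHor k G z a) :=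
    h.fderiv_spray_hor hz a
  rw [h2, h3, h4, h.symm hz] at h1
  linear_combination h1

/-- The derivative of `V G = 0` in a vertical direction. -/
theorem fderiv_accVert (h : IsLocalDefining k G W) (hz : z ∈ W) (a : E) :
    fderiv ℝ G z (0, accVert k G z a) = -2 * fderiv ℝ G z (a, 0) := by
  have h1 : lieD (fun _ => (0, a)) (fun y => fderiv ℝ G y (spray k G y)) z =
      lieD (fun _ => (0, a)) (fun _ => (0 : ℝ)) z :=
    lieD_congr h.isOpen (fun y hy => h.fderiv_spray hy) hz
  rw [lieD_clm_apply (h.contDiffOn_fderiv.differentiableAt_of_isOpen h.isOpen hz)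
    (h.differentiableAt_spray hz)] at h1
  have h2 : lieD (fun _ => (0, a)) (fun _ : E × E => (0 : ℝ)) z = 0 := by simp [lieD]
  have h3 : lieD (fun _ => (0, a)) (fderiv ℝ G) z = fderiv ℝ (fderiv ℝ G) z (0, a) := rfl
  have h4 : lieD (fun _ => (0, a)) (spray k G) z = (a, 0) + (0, accVert k G z a) := by
    refine (h.fderiv_spray_vert hz a).trans ?_
    simp
  rw [h2, h3, h4, h.symm hz, h.euler_lagrange hz, map_add] at h1
  linear_combination h1

/-- This is the second derivative along `V` of `g (v, a) = (k - 1) ∂G/∂v (a)`. It makes `S` vanish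
on `V`. -/
theorem hessTwo_euler (h : IsLocalDefining k G W) (hz : z ∈ W) (a : E) :
    hessTwo k G z z.2 a = fibreHess G z (spray k G z).2 (accVert k G z a) -
      fibreHess G z (accHor k G z z.2) a - fibreHess G z z.2 (accHor k G z a) := by
  have h1 : lieD (spray k G)
      (fun y => hessOne k G y y.2 a + fibreHess G y (spray k G y).2 a) z =
      lieD (spray k G) (fun y => (k - 1) * fderiv ℝ G y (a, 0)) z :=
    lieD_congr h.isOpen (fun y hy => h.hessOne_euler hy a) hz
  have hΓ := h.contDiffOn_fibreHess.differentiableAt_of_isOpen h.isOpen hz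
  have hΓ₁ := h.contDiffOn_hessOne.differentiableAt_of_isOpen h.isOpen hz
  have hG := h.contDiffOn_fderiv.differentiableAt_of_isOpen h.isOpen hz
  have hu : DifferentiableAt ℝ (fun y => (spray k G y).2) z := (h.differentiableAt_spray hz).snd
  have hu' : lieD (spray k G) (fun y => (spray k G y).2) z =
      accHor k G z z.2 + (2 : ℝ) • accVert k G z (spray k G z).2 -
        accVert k G z (spray k G z).2 := by
    have h2 : HasFDerivAt (fun y => (spray k G y).2) _ z :=
      (h.differentiableAt_spray hz).hasFDerivAt.snd
    rw [lieD, h2.fderiv]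
    refine (fderiv_spray_snd k G z _).trans ?_
    rw [h.spray_fst hz, two_smul]
    abel
  have hc1 : DifferentiableAt ℝ (fun y : E × E => hessOne k G y y.2) z :=
    hΓ₁.clm_apply differentiableAt_snd
  have hc2 : DifferentiableAt ℝ (fun y : E × E => fibreHess G y (spray k G y).2) z :=
    hΓ.clm_apply hu
  rw [lieD_const_mul _ (hG.clm_apply (differentiableAt_const _)), h.lieD_fderiv_apply hz,
    h.lieD_hor hz,
    lieD_add (hc1.clm_apply (differentiableAt_const _))
      (hc2.clm_apply (differentiableAt_const _)),
    lieD_clm_apply_const (B := fun y => hessOne k G y y.2) a hc1,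
    lieD_clm_apply_const (B := fun y => fibreHess G y (spray k G y).2) a hc2,
    lieD_clm_apply hΓ₁ differentiableAt_snd, lieD_clm_apply hΓ hu, lieD_snd, hu'] at h1
  have h2 : lieD (spray k G) (hessOne k G) z = hessTwo k G z := rfl
  have h3 : lieD (spray k G) (fibreHess G) z = hessOne k G z := rfl
  rw [h2, h3] at h1
  simp only [add_apply, map_add, map_sub, map_smul, sub_apply, smul_apply, smul_eq_mul] at h1
  have h4 := h.hessOne_eq hz (spray k G z).2 a
  have h5 := h.fibreHess_euler hz (accHor k G z a)
  linear_combination h1 - 2 * h4 + h5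

theorem lieForm_gH_apply (h : IsLocalDefining k G W) (hz : z ∈ W) (X Y : E × E) :
    lieForm (spray k G) (gH G) z X Y =
      hessOne k G z X.1 Y.1 + fibreHess G z X.2 Y.1 + fibreHess G z X.1 Y.2 := by
  have hg : ContDiffOn ℝ ∞ (gH G) W :=
    contDiffOn_bilinearComp h.contDiffOn_fibreHess contDiffOn_const contDiffOn_const
  rw [lieForm_apply,
    ← lieD_clm_apply₂_const X Y (hg.differentiableAt_of_isOpen h.isOpen hz)]
  have h1 : lieD (spray k G) (fun y => gH G y X Y) z = hessOne k G z X.1 Y.1 :=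
    h.lieD_fibreHess_apply hz X.1 Y.1
  have h2 : ∀ X Y : E × E, gH G z X Y = fibreHess G z X.1 Y.1 := fun _ _ => rfl
  rw [h1, h2, h2, h.fderiv_spray_fst hz, h.fderiv_spray_fst hz]

/-- In coordinates `P` is the projection onto vertical vectors whose kernel consists of the `(a, ½
Du (0, a))`. -/
theorem connP_apply (h : IsLocalDefining k G W) (hz : z ∈ W) (X : E × E) :
    connP k G z X = (0, X.2 - (1 / 2 : ℝ) • accVert k G z X.1) := by
  have h1 : connP k G z X = (1 / 2 : ℝ) • (X + (0 - fderiv ℝ (spray k G) z (0, X.1) +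
      (0, (fderiv ℝ (spray k G) z X).1))) := by
    simp [connP, lieEnd, vertEnd]
  rw [h1, h.fderiv_spray_vert hz, h.fderiv_spray_fst hz]
  refine Prod.ext ?_ ?_
  · simp
  · simp only [Prod.snd_add, Prod.smul_snd, Prod.snd_sub, Prod.snd_zero]
    module

/-- The tidal force tensor in coordinates. -/
theorem tidal_apply (h : IsLocalDefining k G W) (hz : z ∈ W) (X Y : E × E) :
    tidal k G z X Y = (1 / 2) * hessTwo k G z X.1 Y.1 +
      (1 / 2) * fibreHess G z (accHor k G z X.1) Y.1 +
      (1 / 2) * fibreHess G z X.1 (accHor k G z Y.1) -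
      (1 / 4) * fibreHess G z (accVert k G z X.1) (accVert k G z Y.1) := by
  have hg : ContDiffOn ℝ ∞ (gH G) W :=
    contDiffOn_bilinearComp h.contDiffOn_fibreHess contDiffOn_const contDiffOn_const
  have hB : ContDiffOn ℝ ∞ (lieForm (spray k G) (gH G)) W :=
    contDiffOn_lieForm h.isOpen h.contDiffOn_spray hg
  have hΓ := h.contDiffOn_fibreHess.differentiableAt_of_isOpen h.isOpen hz
  have hΓ₁ := h.contDiffOn_hessOne.differentiableAt_of_isOpen h.isOpen hz
  have hap : ∀ {B : E × E → E →L[ℝ] E →L[ℝ] ℝ} (_ : DifferentiableAt ℝ B z) (a b : E),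
      DifferentiableAt ℝ (fun y => B y a b) z := fun hB a b =>
    (hB.clm_apply (differentiableAt_const a)).clm_apply (differentiableAt_const b)
  have h1 : lieD (spray k G) (lieForm (spray k G) (gH G)) z X Y =
      hessTwo k G z X.1 Y.1 + hessOne k G z X.2 Y.1 + hessOne k G z X.1 Y.2 := by
    rw [← lieD_clm_apply₂_const X Y (hB.differentiableAt_of_isOpen h.isOpen hz),
      lieD_congr h.isOpen (fun y hy => h.lieForm_gH_apply hy X Y) hz,
      lieD_add ((hap hΓ₁ _ _).fun_add (hap hΓ _ _)) (hap hΓ _ _),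
      lieD_add (hap hΓ₁ _ _) (hap hΓ _ _), h.lieD_hessOne_apply hz,
      h.lieD_fibreHess_apply hz, h.lieD_fibreHess_apply hz]
  have h2 : tidal k G z X Y = (1 / 2) * lieForm (spray k G) (lieForm (spray k G) (gH G)) z X Y -
      fibreHess G z (connP k G z X).2 (connP k G z Y).2 := rfl
  rw [h2, lieForm_apply, h1, h.lieForm_gH_apply hz, h.lieForm_gH_apply hz, h.connP_apply hz,
    h.connP_apply hz, h.fderiv_spray_fst hz, h.fderiv_spray_fst hz, fderiv_spray_snd,
    fderiv_spray_snd]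
  simp only [add_apply, map_add, map_sub, map_smul, sub_apply, smul_apply, smul_eq_mul]
  -- Compatibility of the connection with `g` cancels every term containing a vertical component of
  -- `X` or `Y`.
  have h3 := h.hessOne_eq hz X.2 Y.1
  have h4 := h.hessOne_eq hz X.1 Y.2
  linear_combination h3 + h4

theorem tidal_symm (h : IsLocalDefining k G W) (hz : z ∈ W) (X Y : E × E) :
    tidal k G z X Y = tidal k G z Y X := by
  rw [h.tidal_apply hz, h.tidal_apply hz, h.hessTwo_symm hz X.1, h.fibreHess_symm hz X.1,
    h.fibreHess_symm hz (accHor k G z X.1), h.fibreHess_symm hz (accVert k G z X.1)]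
  ring

/-- Only horizontal components matter in `S`, so the claim reduces to `X = (v, 0)`; there `Du (0, v)
= 2u` and `hessTwo_euler` make all terms cancel. -/
theorem tidal_eq_zero_of_fst_eq_smul (h : IsLocalDefining k G W) (hz : z ∈ W) {X : E × E} {t : ℝ}
    (hX : X.1 = t • z.2) (Y : E × E) : tidal k G z X Y = 0 := by
  have h1 : tidal k G z X Y = t * tidal k G z (z.2, 0) Y := by
    have e1 : accHor k G z (t • z.2) = t • accHor k G z z.2 := by
      have : ((t • z.2, 0) : E × E) = t • (z.2, 0) := by simp
      rw [accHor, this, map_smul]; rfl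
    have e2 : accVert k G z (t • z.2) = t • accVert k G z z.2 := by
      have : ((0, t • z.2) : E × E) = t • (0, z.2) := by simp
      rw [accVert, this, map_smul]; rfl
    rw [h.tidal_apply hz, h.tidal_apply hz, hX, e1, e2]
    simp only [map_smul, smul_apply, smul_eq_mul]
    ring
  rw [h1, h.tidal_apply hz, h.accVert_euler hz, h.hessTwo_euler hz]
  simp only [map_smul, smul_apply, smul_eq_mul]
  ring

/-- The tidal force tensor on the diagonal, in terms of derivatives of `G`. -/
theorem tidal_diag (h : IsLocalDefining k G W) (hz : z ∈ W) (a : E) (X : E × E) (hX : X.1 = a) :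
    tidal k G z X X = (1 / 2) * lieD (spray k G) (lieD (spray k G) fun y => fibreHess G y a a) z +
      fderiv ℝ (fderiv ℝ G) z (a, 0) (a, 0) -
      lieD (spray k G) (fun y => fderiv ℝ (fderiv ℝ G) y (a, 0) (0, a)) z -
      (1 / 4) * fibreHess G z (accVert k G z a) (accVert k G z a) := by
  have h1 : lieD (spray k G) (lieD (spray k G) fun y => fibreHess G y a a) z =
      hessTwo k G z a a := by
    rw [lieD_congr h.isOpen (fun y hy => h.lieD_fibreHess_apply hy a a) hz,
      h.lieD_hessOne_apply hz]
  -- The direction `(a, 0)` need not be tangent to the cone, so `accHor` could not be compared for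
  -- fields known to be related only along the cone; the Jacobi equation eliminates it.
  rw [h.tidal_apply hz, hX, h1, ← h.jacobi_hor hz a a, h.fibreHess_symm hz a]
  ring

end IsLocalDefining

end Tidal

/-! ## Behaviour under generalized conformal transformations -/

section Conformal

variable {E : Type*} [NormedAddCommGroup E] [NormedSpace ℝ E]

theorem lieD_lieD_mul {F : Type*} [NormedAddCommGroup F] [NormedSpace ℝ F] {X : F → F}
    {f g : F → ℝ} {W : Set F} (hW : IsOpen W) (hX : ContDiffOn ℝ ∞ X W)
    (hf : ContDiffOn ℝ ∞ f W) (hg : ContDiffOn ℝ ∞ g W) {z : F} (hz : z ∈ W) :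
    lieD X (lieD X fun y => f y * g y) z = f z * lieD X (lieD X g) z +
      2 * (lieD X f z * lieD X g z) + lieD X (lieD X f) z * g z := by
  have d : ∀ {e : F → ℝ}, ContDiffOn ℝ ∞ e W → DifferentiableAt ℝ e z := fun he =>
    he.differentiableAt_of_isOpen hW hz
  have hXf := contDiffOn_lieD hW hX hf
  have hXg := contDiffOn_lieD hW hX hg
  rw [lieD_congr hW (fun y hy => lieD_mul (X := X) (hf.differentiableAt_of_isOpen hW hy)
      (hg.differentiableAt_of_isOpen hW hy)) hz,
    lieD_add ((d hf).fun_mul (d hXg)) ((d hXf).fun_mul (d hg)), lieD_mul (d hf) (d hXg),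
    lieD_mul (d hXf) (d hg)]
  ring

theorem fderiv_fderiv_mul {F : Type*} [NormedAddCommGroup F] [NormedSpace ℝ F]
    {f g : F → ℝ} {W : Set F} (hW : IsOpen W) (hf : ContDiffOn ℝ ∞ f W)
    (hg : ContDiffOn ℝ ∞ g W) {z : F} (hz : z ∈ W) (A B : F) :
    fderiv ℝ (fderiv ℝ fun y => f y * g y) z A B =
      f z * fderiv ℝ (fderiv ℝ g) z A B + fderiv ℝ f z A * fderiv ℝ g z B +
      fderiv ℝ f z B * fderiv ℝ g z A + fderiv ℝ (fderiv ℝ f) z A B * g z := by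
  have d : ∀ {e : F → ℝ}, ContDiffOn ℝ ∞ e W → DifferentiableAt ℝ e z := fun he =>
    he.differentiableAt_of_isOpen hW hz
  have hap : ∀ {e : F → ℝ}, ContDiffOn ℝ ∞ e W → ContDiffOn ℝ ∞ (fun y => fderiv ℝ e y B) W :=
    fun he => (contDiffOn_fderiv he hW).clm_apply contDiffOn_const
  have hap' : ∀ {e : F → ℝ}, ContDiffOn ℝ ∞ e W →
      lieD (fun _ => A) (fun y => fderiv ℝ e y B) z = fderiv ℝ (fderiv ℝ e) z A B :=
    fun he => lieD_clm_apply_const B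
      ((contDiffOn_fderiv he hW).differentiableAt_of_isOpen hW hz)
  have h1 : ∀ y ∈ W, fderiv ℝ (fun y => f y * g y) y B =
      f y * fderiv ℝ g y B + fderiv ℝ f y B * g y := fun y hy =>
    lieD_mul (X := fun _ => B) (hf.differentiableAt_of_isOpen hW hy)
      (hg.differentiableAt_of_isOpen hW hy)
  rw [← hap' (hf.mul hg), lieD_congr hW h1 hz, lieD_add ((d hf).fun_mul (d (hap hg)))
    ((d (hap hf)).fun_mul (d hg)), lieD_mul (d hf) (d (hap hg)), lieD_mul (d (hap hf)) (d hg),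
    hap' hf, hap' hg]
  simp only [lieD]
  ring

/-- The Euler field `C = vⁱ ∂/∂vⁱ`. -/
def eulerField (z : E × E) : E × E := (0, z.2)

theorem contDiff_eulerField : ContDiff ℝ ∞ (eulerField (E := E)) :=
  contDiff_const.prodMk contDiff_snd

theorem lieD_eulerField (X : E × E → E × E) (z : E × E) :
    lieD X eulerField z = (0, (X z).2) := by
  have hc : HasFDerivAt (eulerField (E := E))
      ((0 : E × E →L[ℝ] E).prod (ContinuousLinearMap.snd ℝ E E)) z :=
    (hasFDerivAt_const (0 : E) z).prodMk hasFDerivAt_snd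
  simp [lieD, hc.fderiv]

/-- Commuting the Euler field past a vertical constant field lowers the degree. -/
theorem lieD_eulerField_vert {f : E × E → ℝ} {W : Set (E × E)} {d : ℝ} (hW : IsOpen W)
    (hf : ContDiffOn ℝ ∞ f W) (he : ∀ z ∈ W, lieD eulerField f z = d * f z) {z : E × E}
    (hz : z ∈ W) (a : E) :
    lieD eulerField (fun y => fderiv ℝ f y (0, a)) z = (d - 1) * fderiv ℝ f z (0, a) := by
  have h1 := fderiv_euler hW hf he hz (0, a)
  have h2 : lieD eulerField (fun y => fderiv ℝ f y (0, a)) z =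
      fderiv ℝ (fderiv ℝ f) z (0, z.2) (0, a) :=
    lieD_clm_apply_const _ ((contDiffOn_fderiv hf hW).differentiableAt_of_isOpen hW hz)
  have hs : IsSymmSndFDerivAt ℝ f z := (hf.contDiffAt (hW.mem_nhds hz)).isSymmSndFDerivAt
    (by rw [minSmoothness_of_isRCLikeNormedField]; exact WithTop.coe_le_coe.2 le_top)
  rw [h2, hs]
  linear_combination h1

theorem lieD_eulerField_hor {f : E × E → ℝ} {W : Set (E × E)} {d : ℝ} (hW : IsOpen W)
    (hf : ContDiffOn ℝ ∞ f W) (he : ∀ z ∈ W, lieD eulerField f z = d * f z) {z : E × E}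
    (hz : z ∈ W) (a : E) :
    lieD eulerField (fun y => fderiv ℝ f y (a, 0)) z = d * fderiv ℝ f z (a, 0) := by
  have h1 := fderiv_euler hW hf he hz (a, 0)
  have h2 : lieD eulerField (fun y => fderiv ℝ f y (a, 0)) z =
      fderiv ℝ (fderiv ℝ f) z (0, z.2) (a, 0) :=
    lieD_clm_apply_const _ ((contDiffOn_fderiv hf hW).differentiableAt_of_isOpen hW hz)
  have hs : IsSymmSndFDerivAt ℝ f z := (hf.contDiffAt (hW.mem_nhds hz)).isSymmSndFDerivAt
    (by rw [minSmoothness_of_isRCLikeNormedField]; exact WithTop.coe_le_coe.2 le_top)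
  rw [h2, hs]
  rw [map_mk_zero_zero, add_zero] at h1
  exact h1

/-- Two defining functions `G` and `G' = J G` in a chart of the tangent bundle, with `J` nowhere zero
and homogeneous of degree `q`. -/
structure IsLocalConformal (k q : ℝ) (G G' J : E × E → ℝ) (W : Set (E × E)) : Prop where
  left : IsLocalDefining k G W
  right : IsLocalDefining (k + q) G' W
  smooth : ContDiffOn ℝ ∞ J W
  euler : ∀ z ∈ W, fderiv ℝ J z (0, z.2) = q * J z
  ne_zero : ∀ z ∈ W, J z ≠ 0
  eq_mul : ∀ z ∈ W, G' z = J z * G z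

/-- The factor `c` in `V̂ = V + c C` along the cone. -/
def shift (k q : ℝ) (G J : E × E → ℝ) (z : E × E) : ℝ :=
  -(fderiv ℝ J z (spray k G z)) / ((k + q - 1) * J z)

/-- The vector field `V + c C`, which along the cone is the dynamical vector field of `J G`. -/
def shifted (k q : ℝ) (G J : E × E → ℝ) (z : E × E) : E × E :=
  spray k G z + shift k q G J z • eulerField z

variable {k q : ℝ} {G G' J : E × E → ℝ} {W : Set (E × E)} {z : E × E}

theorem lieD_shifted {H : Type*} [NormedAddCommGroup H] [NormedSpace ℝ H] (f : E × E → H)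
    (z : E × E) :
    lieD (shifted k q G J) f z =
      lieD (spray k G) f z + shift k q G J z • lieD eulerField f z := by
  simp [lieD, shifted]

namespace IsLocalConformal

theorem fderiv_mul_apply (h : IsLocalConformal k q G G' J W) (hz : z ∈ W) (hG : G z = 0)
    (X : E × E) : fderiv ℝ G' z X = J z * fderiv ℝ G z X := by
  have h1 := lieD_mul (X := fun _ => X) (h.smooth.differentiableAt_of_isOpen h.left.isOpen hz)
    (h.left.smooth.differentiableAt_of_isOpen h.left.isOpen hz)
  rw [hG, mul_zero, add_zero] at h1
  exact (lieD_congr (X := fun _ => X) h.left.isOpen h.eq_mul hz).trans h1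

theorem fderiv_fderiv (h : IsLocalConformal k q G G' J W) (hz : z ∈ W) (A B : E × E) :
    fderiv ℝ (fderiv ℝ G') z A B =
      J z * fderiv ℝ (fderiv ℝ G) z A B + fderiv ℝ J z A * fderiv ℝ G z B +
      fderiv ℝ J z B * fderiv ℝ G z A + fderiv ℝ (fderiv ℝ J) z A B * G z := by
  have h1 : G' =ᶠ[𝓝 z] fun y => J y * G y :=
    Filter.eventuallyEq_of_mem (h.left.isOpen.mem_nhds hz) h.eq_mul
  rw [h1.fderiv.fderiv_eq, fderiv_fderiv_mul h.left.isOpen h.smooth h.left.smooth hz]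

/-- This form of the equation for `c` has no denominators and holds on all of `W`; it is
differentiated vertically in `exists_tidal_diag`. -/
theorem mul_shift (h : IsLocalConformal k q G G' J W) (hz : z ∈ W) :
    (k + q - 1) * (J z * shift k q G J z) = -fderiv ℝ J z (spray k G z) := by
  have h1 := h.ne_zero z hz
  have h2 : k + q - 1 ≠ 0 := sub_ne_zero.2 h.right.ne_one
  rw [shift]
  field_simp

variable [FiniteDimensional ℝ E]

theorem contDiffOn_shift (h : IsLocalConformal k q G G' J W) :
    ContDiffOn ℝ ∞ (shift k q G J) W := by
  have h2 : k + q - 1 ≠ 0 := sub_ne_zero.2 h.right.ne_one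
  refine ContDiffOn.div (((contDiffOn_fderiv h.smooth h.left.isOpen).clm_apply
    h.left.contDiffOn_spray).neg) (contDiffOn_const.mul h.smooth) fun z hz =>
      mul_ne_zero h2 (h.ne_zero z hz)

theorem contDiffOn_shifted (h : IsLocalConformal k q G G' J W) :
    ContDiffOn ℝ ∞ (shifted k q G J) W :=
  h.left.contDiffOn_spray.add (h.contDiffOn_shift.smul contDiff_eulerField.contDiffOn)

/-- Along the cone, the dynamical vector field of `J G` is `V + c C`. -/
theorem spray_eq_shifted (h : IsLocalConformal k q G G' J W) (hz : z ∈ W) (hG : G z = 0) :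
    spray (k + q) G' z = shifted k q G J z := by
  have hsh : shifted k q G J z = (z.2, (spray k G z).2 + shift k q G J z • z.2) := by
    refine Prod.ext ?_ rfl
    simp [shifted, eulerField, h.left.spray_fst hz]
  rw [hsh]
  -- The candidate has first component `v`, so only the Euler-Lagrange equations of `G'` remain. In
  -- their Leibniz expansion the terms in `∂G/∂v (a)` cancel by the choice of `c`.
  refine h.right.spray_eq hz fun a => ?_
  rw [← hsh, h.fderiv_fderiv hz, hG]
  have e1 : fderiv ℝ (fderiv ℝ G) z (shifted k q G J z) (0, a) =
      fderiv ℝ G z (a, 0) + shift k q G J z * ((k - 1) * fderiv ℝ G z (0, a)) := by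
    rw [shifted, map_add, add_apply, h.left.euler_lagrange hz, map_smul, smul_apply, smul_eq_mul,
      ← h.left.fibreHess_euler hz]
    rfl
  have e2 : fderiv ℝ G z (shifted k q G J z) = 0 := by
    rw [shifted, map_add, h.left.fderiv_spray hz, map_smul, eulerField, h.left.euler z hz, hG]
    simp
  have e3 : fderiv ℝ J z (shifted k q G J z) =
      fderiv ℝ J z (spray k G z) + shift k q G J z * (q * J z) := by
    rw [shifted, map_add, map_smul, eulerField, h.euler z hz, smul_eq_mul]
  have e4 := h.fderiv_mul_apply hz hG (a, 0)
  rw [e1, e2, e3, e4]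
  linear_combination fderiv ℝ G z (0, a) * h.mul_shift hz

/-- Functions that agree on the cone have the same derivatives in the directions tangent to
the cone. -/
theorem lieD_eq_of_eqOn (h : IsLocalConformal k q G G' J W) (hz : z ∈ W) (hG : G z = 0)
    (hdG : fderiv ℝ G z ≠ 0) {f g : E × E → ℝ} (hf : ContDiffOn ℝ ∞ f W)
    (hg : ContDiffOn ℝ ∞ g W) (hfg : ∀ y ∈ W, G y = 0 → f y = g y) {X : E × E}
    (hX : fderiv ℝ G z X = 0) : fderiv ℝ f z X = fderiv ℝ g z X := by
  have hW := h.left.isOpen.mem_nhds hz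
  have h1 := fderiv_apply_eq_zero_of_eqOn ((hf.sub hg).contDiffAt hW)
    (h.left.smooth.contDiffAt hW) hG hdG
    (Filter.eventually_of_mem hW fun y hy hGy => sub_eq_zero.2 (hfg y hy hGy)) hX
  have h2 := lieD_sub (X := fun _ => X) (hf.differentiableAt_of_isOpen h.left.isOpen hz)
    (hg.differentiableAt_of_isOpen h.left.isOpen hz)
  exact sub_eq_zero.1 (h2.symm.trans h1)

/-- The derivative of the acceleration of `J G` in a vertical direction tangent to the cone. -/
theorem accVert_mul (h : IsLocalConformal k q G G' J W) (hz : z ∈ W) (hG : G z = 0)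
    (hdG : fderiv ℝ G z ≠ 0) {a : E} (ha : fderiv ℝ G z (0, a) = 0) :
    accVert (k + q) G' z a = accVert k G z a + shift k q G J z • a +
      fderiv ℝ (shift k q G J) z (0, a) • z.2 := by
  have hV' := h.right.contDiffOn_spray
  have hY := h.contDiffOn_shifted
  -- The two fields are known to agree only on the cone, but `(0, a)` is tangent to it. Linear
  -- functionals reduce the vector identity to scalar functions.
  have key : lieD (fun _ => (0, a)) (spray (k + q) G') z =
      lieD (fun _ => (0, a)) (shifted k q G J) z := by
    rw [← sub_eq_zero]
    by_contra hne
    obtain ⟨φ, hφ⟩ := SeparatingDual.exists_ne_zero (R := ℝ) hne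
    refine hφ ?_
    have hφd : ∀ {f : E × E → E × E}, ContDiffOn ℝ ∞ f W →
        φ (lieD (fun _ => (0, a)) f z) = fderiv ℝ (fun y => φ (f y)) z (0, a) := by
      intro f hf
      have := (φ.hasFDerivAt.comp z
        (hf.differentiableAt_of_isOpen h.left.isOpen hz).hasFDerivAt).fderiv
      exact (DFunLike.congr_fun this (0, a)).symm
    rw [map_sub, sub_eq_zero, hφd hV', hφd hY]
    exact h.lieD_eq_of_eqOn hz hG hdG (φ.contDiff.comp_contDiffOn hV')
      (φ.contDiff.comp_contDiffOn hY)
      (fun y hy hGy => congrArg φ (h.spray_eq_shifted hy hGy)) ha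
  have hc := h.contDiffOn_shift.differentiableAt_of_isOpen h.left.isOpen hz
  have hC : DifferentiableAt ℝ (eulerField (E := E)) z :=
    (contDiff_eulerField.differentiable (by simp)).differentiableAt
  have h2 : lieD (fun _ => (0, a)) (shifted k q G J) z =
      lieD (fun _ => (0, a)) (spray k G) z + (shift k q G J z • (0, a) +
        fderiv ℝ (shift k q G J) z (0, a) • eulerField z) := by
    have := lieD_add (X := fun _ => (0, a)) (h.left.differentiableAt_spray hz) (hc.fun_smul hC)
    rw [lieD_smul hc hC, lieD_eulerField] at this
    exact this
  have h3 : accVert (k + q) G' z a =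
      (lieD (fun _ => (0, a)) (spray (k + q) G') z).2 := rfl
  rw [h3, key, h2, add_assoc]
  rfl

/-- The second derivative along the cone of a component of the fibre Hessian of `J G`. -/
theorem lieD_lieD_fibreHess_mul (h : IsLocalConformal k q G G' J W) (hz : z ∈ W) (hG : G z = 0)
    (hdG : fderiv ℝ G z ≠ 0) (a : E) :
    lieD (spray (k + q) G') (lieD (spray (k + q) G')
        fun y => fibreHess G' y a a) z =
      lieD (shifted k q G J) (lieD (shifted k q G J) fun y =>
        J y * fibreHess G y a a + 2 * (fderiv ℝ J y (0, a) * fderiv ℝ G y (0, a)) +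
          fderiv ℝ (fderiv ℝ J) y (0, a) (0, a) * G y) z := by
  have hW := h.left.isOpen
  have hY := h.contDiffOn_shifted
  have hV' := h.right.contDiffOn_spray
  have hγ' : ContDiffOn ℝ ∞ (fun y => fibreHess G' y a a) W :=
    (h.right.contDiffOn_fibreHess.clm_apply contDiffOn_const).clm_apply contDiffOn_const
  have hYG : fderiv ℝ G z (shifted k q G J z) = 0 := by
    rw [shifted, map_add, h.left.fderiv_spray hz, map_smul, eulerField, h.left.euler z hz, hG]
    simp
  have h1 : lieD (spray (k + q) G') (lieD (spray (k + q) G')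
        fun y => fibreHess G' y a a) z =
      lieD (shifted k q G J) (lieD (shifted k q G J)
        fun y => fibreHess G' y a a) z := by
    have : ∀ f : E × E → ℝ, lieD (spray (k + q) G') f z =
        lieD (shifted k q G J) f z := fun f => by rw [lieD, h.spray_eq_shifted hz hG]; rfl
    rw [this]
    -- The inner derivatives agree only at points of the cone; this suffices because the outer one
    -- is along a field tangent to the cone.
    refine h.lieD_eq_of_eqOn hz hG hdG (contDiffOn_lieD hW hV' hγ') (contDiffOn_lieD hW hY hγ')
      (fun y hy hGy => ?_) hYG
    rw [lieD, h.spray_eq_shifted hy hGy]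
    rfl
  rw [h1]
  refine lieD_congr hW (fun y hy => lieD_congr hW (fun x hx => ?_) hy) hz
  rw [fibreHess_apply, h.fderiv_fderiv hx, ← fibreHess_apply]
  ring

/-- On the vectors annihilated by `dG/dv`, the tidal force tensors of `J G` and of `G` differ by
the factor `J` and a multiple of the fibre Hessian. -/
theorem exists_tidal_diag (h : IsLocalConformal k q G G' J W) (hz : z ∈ W) (hG : G z = 0)
    (hdG : fderiv ℝ G z ≠ 0) :
    ∃ κ : ℝ, ∀ X : E × E, fderiv ℝ G z (0, X.1) = 0 →
      tidal (k + q) G' z X X =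
        J z * tidal k G z X X + κ * fibreHess G z X.1 X.1 := by
  have hW := h.left.isOpen
  have hV := h.left.contDiffOn_spray
  have hV' := h.right.contDiffOn_spray
  have hY := h.contDiffOn_shifted
  have hc := h.contDiffOn_shift
  have hC : ContDiffOn ℝ ∞ (eulerField (E := E)) W := contDiff_eulerField.contDiffOn
  have d : ∀ {e : E × E → ℝ}, ContDiffOn ℝ ∞ e W → DifferentiableAt ℝ e z := fun he =>
    he.differentiableAt_of_isOpen hW hz
  set c := shift k q G J with hcdef
  set V := spray k G with hVdef
  set Y := shifted k q G J with hYdef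
  -- This `κ` is the coefficient of `g (a, a)`: the first three terms come from the second
  -- derivative of `J γ` along `Y`, where `γ = g (a, a)` has degree `k - 2`, and `-¼ J c²` comes
  -- from the connection term. It does not involve `a`.
  refine ⟨(1 / 2) * J z * (k - 2) * (lieD Y c z + c z * (c z * (k - 2))) +
    lieD Y J z * (c z * (k - 2)) + (1 / 2) * lieD Y (lieD Y J) z - (1 / 4) * J z * c z ^ 2,
    fun X hX => ?_⟩
  obtain ⟨a, ha⟩ : ∃ a, X.1 = a := ⟨_, rfl⟩
  rw [ha] at hX ⊢
  rw [h.right.tidal_diag hz a X ha, h.left.tidal_diag hz a X ha,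
    h.lieD_lieD_fibreHess_mul hz hG hdG, ← hYdef, ← hVdef]
  -- the functions involved
  have h1 : ∀ {e : E × E → ℝ} (b : E × E), ContDiffOn ℝ ∞ e W →
      ContDiffOn ℝ ∞ (fun y => fderiv ℝ e y b) W :=
    fun b he => (contDiffOn_fderiv he hW).clm_apply contDiffOn_const
  have h2 : ∀ {e : E × E → ℝ} (b b' : E × E), ContDiffOn ℝ ∞ e W →
      ContDiffOn ℝ ∞ (fun y => fderiv ℝ (fderiv ℝ e) y b b') W := fun b b' he =>
    ((contDiffOn_fderiv (contDiffOn_fderiv he hW) hW).clm_apply contDiffOn_const).clm_apply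
      contDiffOn_const
  have hGs := h.left.smooth
  have hJs := h.smooth
  set p : E × E → ℝ := fun y => fderiv ℝ G y (0, a) with hp
  set r : E × E → ℝ := fun y => fderiv ℝ G y (a, 0) with hr
  set j : E × E → ℝ := fun y => fderiv ℝ J y (0, a) with hj
  set i : E × E → ℝ := fun y => fderiv ℝ J y (a, 0) with hi
  set γ : E × E → ℝ := fun y => fibreHess G y a a with hγ
  set m : E × E → ℝ := fun y => fderiv ℝ (fderiv ℝ G) y (a, 0) (0, a) with hm
  set jj : E × E → ℝ := fun y => fderiv ℝ (fderiv ℝ J) y (0, a) (0, a) with hjj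
  set ij : E × E → ℝ := fun y => fderiv ℝ (fderiv ℝ J) y (a, 0) (0, a) with hij
  have sp : ContDiffOn ℝ ∞ p W := h1 _ hGs
  have sr : ContDiffOn ℝ ∞ r W := h1 _ hGs
  have sj : ContDiffOn ℝ ∞ j W := h1 _ hJs
  have si : ContDiffOn ℝ ∞ i W := h1 _ hJs
  have sγ : ContDiffOn ℝ ∞ γ W := h2 (0, a) (0, a) hGs
  have sm : ContDiffOn ℝ ∞ m W := h2 _ _ hGs
  have sjj : ContDiffOn ℝ ∞ jj W := h2 _ _ hJs
  have sij : ContDiffOn ℝ ∞ ij W := h2 _ _ hJs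
  have hpz : p z = 0 := hX
  -- derivatives along `Y`
  have hYf : ∀ (f : E × E → ℝ) (y : E × E), lieD Y f y = lieD V f y + c y * lieD eulerField f y :=
    fun f y => lieD_shifted f y
  have YG : ∀ y ∈ W, lieD Y G y = k * (c y * G y) := by
    intro y hy
    have e1 : lieD V G y = 0 := h.left.fderiv_spray hy
    have e2 : lieD eulerField G y = k * G y := h.left.euler y hy
    rw [hYf, e1, e2]
    ring
  have Cp : ∀ y ∈ W, lieD eulerField p y = (k - 1) * p y := fun y hy =>
    lieD_eulerField_vert hW hGs h.left.euler hy a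
  have Yp : ∀ y ∈ W, lieD Y p y = r y + (k - 1) * (c y * p y) := by
    intro y hy
    have e1 : lieD V p y = r y := by
      rw [hp, h.left.lieD_fderiv_apply hy, hVdef, h.left.euler_lagrange hy]
    rw [hYf, e1, Cp y hy]
    ring
  have Yr : lieD Y r z = -fderiv ℝ G z (0, accHor k G z a) + c z * (k * r z) := by
    have e1 : lieD V r z = -fderiv ℝ G z (0, accHor k G z a) := by
      rw [hr, h.left.lieD_fderiv_apply hz, hVdef, h.left.lieD_hor hz]
    rw [hYf, e1, lieD_eulerField_hor hW hGs h.left.euler hz]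
  have hpm : ∀ y ∈ W, fderiv ℝ p y (a, 0) = m y := fun y hy =>
    h.left.lieD_fderiv_apply hy (fun _ => (a, 0)) _
  have hpγ : ∀ y ∈ W, fderiv ℝ p y (0, a) = γ y := fun y hy =>
    h.left.lieD_fderiv_apply hy (fun _ => (0, a)) _
  have Ym : lieD Y m z = lieD V m z + c z * ((k - 1) * m z) := by
    have e1 := lieD_eulerField_hor hW sp Cp hz a
    rw [hpm z hz, lieD_congr hW hpm hz] at e1
    rw [hYf, e1]
  have Cγ : ∀ y ∈ W, lieD eulerField γ y = (k - 2) * γ y := by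
    intro y hy
    have e1 := lieD_eulerField_vert hW sp Cp hy a
    rw [hpγ y hy, lieD_congr hW hpγ hy] at e1
    linear_combination e1
  have Yγ : ∀ y ∈ W, lieD Y γ y = lieD V γ y + (k - 2) * (c y * γ y) := by
    intro y hy
    rw [hYf, Cγ y hy]
    ring
  -- The field `V` is homogeneous of degree two, that is `[C, V] = V`, so differentiating along `V`
  -- raises the degree by one.
  have CVγ : lieD eulerField (lieD V γ) z = (k - 1) * lieD V γ z := by
    have e1 := lieD_lieD hW sγ hC hV hz
    have e2 : lieD V eulerField z = (0, (V z).2) := lieD_eulerField V z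
    have e3 : lieD eulerField V z = (z.2, (V z).2) + (0, (V z).2) := by
      refine (h.left.fderiv_spray_vert hz z.2).trans ?_
      rw [h.left.accVert_euler hz, two_smul]
      simp [hVdef]
    have e4 : ((z.2, (V z).2) : E × E) = V z := (h.left.spray_eq_mk hz).symm
    have e5 : lieD V (lieD eulerField γ) z = (k - 2) * lieD V γ z := by
      rw [lieD_congr hW Cγ hz, lieD_const_mul _ (d sγ)]
    rw [e2, e3, e4, e5, map_add] at e1
    have e6 : fderiv ℝ γ z (V z) = lieD V γ z := rfl
    linear_combination e1 + e6
  have sVγ := contDiffOn_lieD hW hV sγ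
  have YYγ : lieD Y (lieD Y γ) z = lieD V (lieD V γ) z + c z * ((k - 1) * lieD V γ z) +
      (k - 2) * (c z * lieD Y γ z + lieD Y c z * γ z) := by
    rw [lieD_congr hW Yγ hz, lieD_add (d sVγ) ((d (hc.mul sγ)).const_mul _), hYf (lieD V γ) z,
      CVγ, lieD_const_mul _ (d (hc.mul sγ)), lieD_mul (d hc) (d sγ)]
  have YYG : lieD Y (lieD Y G) z = 0 := by
    rw [lieD_congr hW YG hz, lieD_const_mul _ (d (hc.mul hGs)), lieD_mul (d hc) (d hGs),
      YG z hz, hG]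
    ring
  have YYp : lieD Y (lieD Y p) z = lieD Y r z + (k - 1) * (c z * r z) := by
    rw [lieD_congr hW Yp hz, lieD_add (d sr) ((d (hc.mul sp)).const_mul _),
      lieD_const_mul _ (d (hc.mul sp)), lieD_mul (d hc) (d sp), Yp z hz, hpz]
    ring
  have Yj : lieD Y j z = lieD V j z + c z * ((q - 1) * j z) := by
    rw [hYf, lieD_eulerField_vert hW hJs h.euler hz]
  have YJ : lieD Y J z = fderiv ℝ J z (V z) + c z * (q * J z) := by
    have e2 : lieD eulerField J z = q * J z := h.euler z hz
    rw [hYf, e2]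
    rfl
  -- the second derivative of the Hessian
  have T1 : lieD Y (lieD Y fun y => J y * γ y + 2 * (j y * p y) + jj y * G y) z =
      J z * lieD Y (lieD Y γ) z + 2 * (lieD Y J z * lieD Y γ z) + lieD Y (lieD Y J) z * γ z +
        2 * (j z * lieD Y (lieD Y p) z + 2 * (lieD Y j z * r z)) := by
    have s1 := hJs.mul sγ
    have s2 := sj.mul sp
    have s3 := sjj.mul hGs
    have e1 : ∀ y ∈ W, lieD Y (fun y => J y * γ y + 2 * (j y * p y) + jj y * G y) y =
        lieD Y (fun y => J y * γ y) y + 2 * lieD Y (fun y => j y * p y) y +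
          lieD Y (fun y => jj y * G y) y := by
      intro y hy
      have d1 := s1.differentiableAt_of_isOpen hW hy
      have d2 := s2.differentiableAt_of_isOpen hW hy
      have d3 := s3.differentiableAt_of_isOpen hW hy
      have d4 : DifferentiableAt ℝ (fun y => 2 * (j y * p y)) y := d2.const_mul 2
      rw [lieD_add (DifferentiableAt.fun_add d1 d4) d3, lieD_add d1 d4, lieD_const_mul _ d2]
    have t1 := contDiffOn_lieD hW hY s1
    have t2 := contDiffOn_lieD hW hY s2
    have t3 := contDiffOn_lieD hW hY s3
    have d4 : DifferentiableAt ℝ (fun y => 2 * lieD Y (fun y => j y * p y) y) z :=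
      (d t2).const_mul 2
    have e2 := lieD_lieD_mul hW hY hJs sγ hz
    have e3 := lieD_lieD_mul hW hY sj sp hz
    have e4 := lieD_lieD_mul hW hY sjj hGs hz
    have e5 := YG z hz
    have e6 := Yp z hz
    rw [hG] at e5
    rw [hpz] at e6
    rw [YYG, e5, hG] at e4
    rw [hpz, e6] at e3
    rw [lieD_congr hW e1 hz, lieD_add (DifferentiableAt.fun_add (d t1) d4) (d t3),
      lieD_add (d t1) d4, lieD_const_mul _ (d t2)]
    linear_combination e2 + 2 * e3 + e4
  -- the other terms
  have T2 : fderiv ℝ (fderiv ℝ G') z (a, 0) (a, 0) =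
      J z * fderiv ℝ (fderiv ℝ G) z (a, 0) (a, 0) + 2 * (i z * r z) := by
    rw [h.fderiv_fderiv hz, hG]
    ring
  have T3 : lieD (spray (k + q) G')
      (fun y => fderiv ℝ (fderiv ℝ G') y (a, 0) (0, a)) z =
      J z * lieD Y m z + lieD Y J z * m z + i z * r z + j z * lieD Y r z + lieD Y j z * r z := by
    have e0 : ∀ f : E × E → ℝ, lieD (spray (k + q) G') f z = lieD Y f z :=
      fun f => by rw [lieD, h.spray_eq_shifted hz hG]; rfl
    have e1 : ∀ y ∈ W, fderiv ℝ (fderiv ℝ G') y (a, 0) (0, a) =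
        J y * m y + i y * p y + j y * r y + ij y * G y :=
      fun y hy => h.fderiv_fderiv hy _ _
    have e5 := YG z hz
    have e6 := Yp z hz
    rw [e0, lieD_congr hW e1 hz,
      lieD_add (((d hJs).fun_mul (d sm)).fun_add ((d si).fun_mul (d sp)) |>.fun_add
        ((d sj).fun_mul (d sr))) ((d sij).fun_mul (d hGs)),
      lieD_add (((d hJs).fun_mul (d sm)).fun_add ((d si).fun_mul (d sp)))
        ((d sj).fun_mul (d sr)),
      lieD_add ((d hJs).fun_mul (d sm)) ((d si).fun_mul (d sp)), lieD_mul (d hJs) (d sm),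
      lieD_mul (d si) (d sp), lieD_mul (d sj) (d sr), lieD_mul (d sij) (d hGs), e5, e6, hpz, hG]
    ring
  have hV1 : lieD V γ z = -fibreHess G z (accVert k G z a) a := by
    rw [hγ, hVdef, h.left.lieD_fibreHess_apply hz, h.left.hessOne_eq hz, h.left.fibreHess_symm hz a]
    ring
  set b := accVert k G z a with hb
  set Dc := fderiv ℝ c z (0, a) with hDc
  have Jb : fderiv ℝ J z (0, b + c z • a + Dc • z.2) =
      fderiv ℝ J z (0, b) + c z * j z + Dc * (q * J z) := by
    have e1 : ((0, b + c z • a + Dc • z.2) : E × E) = (0, b) + c z • (0, a) + Dc • (0, z.2) := by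
      simp
    rw [e1, map_add, map_add, map_smul, map_smul, h.euler z hz]
    rfl
  have Gb : fderiv ℝ G z (0, b + c z • a + Dc • z.2) = -2 * r z := by
    have e1 : ((0, b + c z • a + Dc • z.2) : E × E) = (0, b) + c z • (0, a) + Dc • (0, z.2) := by
      simp
    rw [e1, map_add, map_add, map_smul, map_smul, h.left.euler z hz, hG, hb,
      h.left.fderiv_accVert hz, hX]
    simp [hr]
  -- On the cone `g (v, v) = g (v, a) = 0`, so the unknown derivative `Dc` enters only through `g
  -- (v, b)`.
  have gb : fibreHess G z (b + c z • a + Dc • z.2) (b + c z • a + Dc • z.2) =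
      fibreHess G z b b - 2 * (c z * lieD V γ z) + c z ^ 2 * γ z - 4 * (Dc * ((k - 1) * r z)) := by
    have e1 : fibreHess G z z.2 b = (k - 1) * (-2 * r z) := by
      rw [h.left.fibreHess_euler hz, hb, h.left.fderiv_accVert hz]
    have e2 : fibreHess G z z.2 a = 0 := by rw [h.left.fibreHess_euler hz, hX, mul_zero]
    have e3 : fibreHess G z z.2 z.2 = 0 := by
      rw [h.left.fibreHess_euler hz, h.left.euler z hz, hG, mul_zero, mul_zero]
    have e4 : γ z = fibreHess G z a a := rfl
    simp only [map_add, map_smul, add_apply, smul_apply, smul_eq_mul]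
    rw [h.left.fibreHess_symm hz b z.2, h.left.fibreHess_symm hz a z.2,
      h.left.fibreHess_symm hz a b, e1, e2, e3, hV1, e4]
    ring
  have T4 : fibreHess G' z (accVert (k + q) G' z a)
      (accVert (k + q) G' z a) =
      J z * (fibreHess G z b b - 2 * (c z * lieD V γ z) + c z ^ 2 * γ z -
        4 * (Dc * ((k - 1) * r z))) -
      4 * r z * (fderiv ℝ J z (0, b) + c z * j z + Dc * (q * J z)) := by
    rw [h.accVert_mul hz hG hdG hX, fibreHess_apply, h.fderiv_fderiv hz,
      ← fibreHess_apply, ← hcdef, ← hb, ← hDc, Jb, Gb, gb, hG]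
    ring
  -- the equation defining `c`, and its vertical derivative
  have R1 : (k + q - 1) * (J z * c z) = -fderiv ℝ J z (V z) := h.mul_shift hz
  have R2 : (k + q - 1) * (J z * Dc + j z * c z) =
      -(lieD V j z + i z + fderiv ℝ J z (0, b)) := by
    have e1 : lieD (fun _ => (0, a)) (fun y => (k + q - 1) * (J y * c y)) z =
        lieD (fun _ => (0, a)) (fun y => -1 * lieD V J y) z :=
      lieD_congr hW (fun y hy => (h.mul_shift hy).trans (neg_one_mul _).symm) hz
    have e2 := lieD_lieD hW hJs (contDiffOn_const (c := ((0, a) : E × E))) hV hz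
    have e3 : lieD V (fun _ : E × E => ((0, a) : E × E)) z = 0 := by simp [lieD]
    have e4 : lieD (fun _ => (0, a)) V z = (a, 0) + (0, b) := by
      refine (h.left.fderiv_spray_vert hz a).trans ?_
      simp [hb]
    have e5 : lieD V (lieD (fun _ => (0, a)) J) z = lieD V j z := rfl
    rw [e3, e4, e5, map_zero, add_zero, map_add] at e2
    rw [lieD_const_mul _ ((d hJs).fun_mul (d hc)), lieD_mul (d hJs) (d hc),
      lieD_const_mul _ (d (contDiffOn_lieD hW hV hJs)), e2] at e1
    have e6 : lieD (fun _ => (0, a)) c z = Dc := rfl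
    have e7 : lieD (fun _ => (0, a)) J z = j z := rfl
    have e8 : fderiv ℝ J z (a, 0) = i z := rfl
    rw [e6, e7, e8] at e1
    linear_combination e1
  have e9 : fibreHess G z a a = γ z := rfl
  -- Beyond `J S` and the multiples of `γ` there remain terms in `Vγ`, `m` and `r`. The equation for
  -- `c` disposes of the first two, its vertical derivative of the third.
  rw [T1, T2, T3, T4, YYγ, YYp, Ym, Yr, Yj, YJ, Yγ z hz, e9]
  linear_combination (lieD V γ z - m z) * R1 + r z * R2

end IsLocalConformal

end Conformal

/-! ## Forms on quotients and raising an index -/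

section LinearAlgebra

variable {Q Q' : Type*} [AddCommGroup Q] [Module ℝ Q] [AddCommGroup Q'] [Module ℝ Q']

theorem descend_mk {N : Submodule ℝ Q} {B : LinearMap.BilinForm ℝ Q}
    (h : ∀ X ∈ N, ∀ Y, B X Y = 0 ∧ B Y X = 0) (X Y : Q) :
    descend N B (N.mkQ X) (N.mkQ Y) = B X Y := by
  rw [descend, dif_pos h]
  rfl

theorem raiseIndex_apply [FiniteDimensional ℝ Q] {g : LinearMap.BilinForm ℝ Q}
    (hg : g.Nondegenerate) (s : LinearMap.BilinForm ℝ Q) (X Y : Q) :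
    g (raiseIndex g s X) Y = s X Y := by
  rw [raiseIndex, dif_pos hg]
  exact LinearMap.BilinForm.apply_toDual_symm_apply (hB := hg) (s X) Y

theorem raiseIndex_eq [FiniteDimensional ℝ Q] {g : LinearMap.BilinForm ℝ Q}
    (hg : g.Nondegenerate) {s : LinearMap.BilinForm ℝ Q} {A : Module.End ℝ Q}
    (hA : ∀ X Y, g (A X) Y = s X Y) : raiseIndex g s = A := by
  ext X
  rw [← sub_eq_zero]
  refine hg.1 _ fun Y => ?_
  rw [map_sub, LinearMap.sub_apply, raiseIndex_apply hg, hA, sub_self]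

theorem nondegenerate_of_equiv {g : LinearMap.BilinForm ℝ Q} {g' : LinearMap.BilinForm ℝ Q'}
    (e : Q ≃ₗ[ℝ] Q') {c : ℝ} (hc : c ≠ 0) (hg : g.Nondegenerate)
    (hg' : ∀ X Y, g' (e X) (e Y) = c * g X Y) : g'.Nondegenerate := by
  constructor
  · intro X hX
    obtain ⟨X, rfl⟩ := e.surjective X
    rw [hg.1 X fun Y => ?_, map_zero]
    exact (mul_eq_zero.1 ((hg' X Y).symm.trans (hX (e Y)))).resolve_left hc
  · intro X hX
    obtain ⟨X, rfl⟩ := e.surjective X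
    rw [hg.2 X fun Y => ?_, map_zero]
    exact (mul_eq_zero.1 ((hg' Y X).symm.trans (hX (e Y)))).resolve_left hc

/-- The factor `c` cancels between form and metric, and the added multiple of `g` becomes a multiple
of the identity. -/
theorem raiseIndex_conj [FiniteDimensional ℝ Q] [FiniteDimensional ℝ Q']
    {g s : LinearMap.BilinForm ℝ Q} {g' s' : LinearMap.BilinForm ℝ Q'} (e : Q ≃ₗ[ℝ] Q') {c κ : ℝ}
    (hc : c ≠ 0) (hg : g.Nondegenerate) (hg' : ∀ X Y, g' (e X) (e Y) = c * g X Y)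
    (hs' : ∀ X Y, s' (e X) (e Y) = c * s X Y + κ * g X Y) :
    raiseIndex g' s' = e.conj (raiseIndex g s + (κ / c) • LinearMap.id) := by
  refine raiseIndex_eq (nondegenerate_of_equiv e hc hg hg') fun X Y => ?_
  obtain ⟨X, rfl⟩ := e.surjective X
  obtain ⟨Y, rfl⟩ := e.surjective Y
  rw [LinearEquiv.conj_apply_apply, e.symm_apply_apply, hg', hs']
  simp only [LinearMap.add_apply, LinearMap.smul_apply, LinearMap.id_apply, map_add, map_smul,
    smul_eq_mul, raiseIndex_apply hg]
  field_simp

/-- The trace-free part of a form, with one index raised, does not change if the form is rescaled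
together with the metric and a multiple of the metric is added. -/
theorem traceFree_of_equiv [FiniteDimensional ℝ Q] [FiniteDimensional ℝ Q']
    {g s : LinearMap.BilinForm ℝ Q} {g' s' : LinearMap.BilinForm ℝ Q'} (e : Q ≃ₗ[ℝ] Q') {c κ n : ℝ}
    (hc : c ≠ 0) (hg : g.Nondegenerate) (hg' : ∀ X Y, g' (e X) (e Y) = c * g X Y)
    (hs' : ∀ X Y, s' (e X) (e Y) = c * s X Y + κ * g X Y)
    (hn : (Module.finrank ℝ Q : ℝ) = n) (X Y : Q) :
    (s' - (LinearMap.trace ℝ _ (raiseIndex g' s') / n) • g') (e X) (e Y) =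
      c * (s - (LinearMap.trace ℝ _ (raiseIndex g s) / n) • g) X Y := by
  have ht : LinearMap.trace ℝ _ (raiseIndex g' s') =
      LinearMap.trace ℝ _ (raiseIndex g s) + κ / c * n := by
    rw [raiseIndex_conj e hc hg hg' hs', LinearMap.trace_conj', map_add, map_smul,
      LinearMap.trace_id, hn, smul_eq_mul]
  simp only [LinearMap.sub_apply, LinearMap.smul_apply, smul_eq_mul, hg', hs', ht]
  -- For `n = 0` the quotient is a division by zero, but then `Q` is the zero space and both sides
  -- vanish. This is the case of a two-dimensional base.
  by_cases h0 : n = 0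
  · have : X = 0 := by
      have h1 : Module.finrank ℝ Q = 0 := by exact_mod_cast hn.trans h0
      exact (Module.finrank_zero_iff.1 h1).elim X 0
    simp [this]
  · field_simp
    ring

end LinearAlgebra

/-! ## The umbral space in a chart -/

section Umbral

variable {E : Type*} [NormedAddCommGroup E] [NormedSpace ℝ E]
variable {k q : ℝ} {G G' J : E × E → ℝ} {W : Set (E × E)} {z : E × E}

theorem mem_vertCone {X : E × E} : X ∈ vertCone G z ↔ fderiv ℝ G z X = 0 ∧ X.1 = 0 :=
  Iff.rfl

theorem mem_lamCone {X : E × E} :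
    X ∈ lamCone G z ↔ fderiv ℝ G z X = 0 ∧ fderiv ℝ G z (0, X.1) = 0 :=
  ⟨fun h => ⟨h.1, h.2.1⟩, fun h => ⟨h.1, h.2, rfl⟩⟩

theorem gH_apply (X Y : E × E) : gH G z X Y = fibreHess G z X.1 Y.1 := rfl

/-- A horizontal vector annihilated by `dG/dv` has a lift to `Λ`. -/
theorem exists_mem_lamCone {w : E} (hw : fderiv ℝ G z (0, w) ≠ 0) {a : E}
    (ha : fderiv ℝ G z (0, a) = 0) : ∃ X ∈ lamCone G z, X.1 = a := by
  refine ⟨(a, (-(fderiv ℝ G z (a, 0)) / fderiv ℝ G z (0, w)) • w), mem_lamCone.2 ⟨?_, ha⟩, rfl⟩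
  have : ((a, (-(fderiv ℝ G z (a, 0)) / fderiv ℝ G z (0, w)) • w) : E × E) =
      (a, 0) + (-(fderiv ℝ G z (a, 0)) / fderiv ℝ G z (0, w)) • (0, w) := by simp
  rw [this, map_add, map_smul, smul_eq_mul, div_mul_cancel₀ _ hw]
  ring

namespace IsLocalDefining

theorem fibreHess_smul_euler (h : IsLocalDefining k G W) (hz : z ∈ W) (t : ℝ) (a : E) :
    fibreHess G z (t • z.2) a = t * ((k - 1) * fderiv ℝ G z (0, a)) := by
  rw [map_smul, smul_apply, h.fibreHess_euler hz, smul_eq_mul]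

theorem snd_ne_zero (h : IsLocalDefining k G W) (hz : z ∈ W) {w : E}
    (hw : fderiv ℝ G z (0, w) ≠ 0) : z.2 ≠ 0 := by
  intro h0
  have h1 := h.fibreHess_euler hz w
  rw [h0, map_zero, zero_apply] at h1
  exact mul_ne_zero (sub_ne_zero.2 h.ne_one) hw h1.symm

/-- The radical of the fibre Hessian on the kernel of `dG/dv` is spanned by `v`. -/
theorem eq_smul_of_fibreHess_eq_zero (h : IsLocalDefining k G W) (hz : z ∈ W)
    {w : E} (hw : fderiv ℝ G z (0, w) ≠ 0) {a : E}
    (ha : ∀ b, fderiv ℝ G z (0, b) = 0 → fibreHess G z a b = 0) : ∃ t : ℝ, a = t • z.2 := by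
  have hk : k - 1 ≠ 0 := sub_ne_zero.2 h.ne_one
  -- The functional `g (a, ·)` vanishes on the kernel of `∂G/∂v`, hence is a multiple of `g (v, ·)`;
  -- evaluating both at `w` fixes the factor.
  refine ⟨fibreHess G z a w / ((k - 1) * fderiv ℝ G z (0, w)), sub_eq_zero.1 ?_⟩
  refine h.nondeg z hz _ fun b => ?_
  set s := fderiv ℝ G z (0, b) / fderiv ℝ G z (0, w) with hs
  have hb : fderiv ℝ G z (0, b - s • w) = 0 := by
    have : ((0, b - s • w) : E × E) = (0, b) - s • (0, w) := by simp
    rw [this, map_sub, map_smul, smul_eq_mul, hs, div_mul_cancel₀ _ hw, sub_self]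
  have h1 := ha _ hb
  rw [map_sub, map_smul, smul_eq_mul] at h1
  rw [map_sub, sub_apply, h.fibreHess_smul_euler hz]
  rw [hs] at h1
  field_simp at h1 ⊢
  linear_combination h1

variable [FiniteDimensional ℝ E]

/-- Subtracting `t V` leaves a tangent vertical vector, because `V G = 0`. In this description the
dynamical field no longer appears, so defining functions can be compared directly. -/
theorem mem_nullCone (h : IsLocalDefining k G W) (hz : z ∈ W) {X : E × E} :
    X ∈ nullCone k G z ↔ fderiv ℝ G z X = 0 ∧ ∃ t : ℝ, X.1 = t • z.2 := by
  rw [nullCone, Submodule.mem_sup]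
  constructor
  · rintro ⟨Y, hY, Z, hZ, rfl⟩
    obtain ⟨t, rfl⟩ := Submodule.mem_span_singleton.1 hZ
    rw [mem_vertCone] at hY
    refine ⟨by rw [map_add, hY.1, map_smul, h.fderiv_spray hz, smul_zero, add_zero], t, ?_⟩
    rw [Prod.fst_add, hY.2, Prod.smul_fst, h.spray_fst hz, zero_add]
  · rintro ⟨hX, t, ht⟩
    refine ⟨X - t • spray k G z, mem_vertCone.2 ⟨?_, ?_⟩, t • spray k G z,
      Submodule.smul_mem _ _ (Submodule.mem_span_singleton_self _), by abel⟩
    · rw [map_sub, hX, map_smul, h.fderiv_spray hz, smul_zero, sub_zero]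
    · rw [Prod.fst_sub, Prod.smul_fst, h.spray_fst hz, ht, sub_self]

/-- The projection `X ↦ X.1` identifies the umbral space with `ker (∂G/∂v) / ⟨v⟩`, of dimension `(n
- 1) - 1`; `v` lies in that kernel because `G = 0`. -/
theorem finrank_umbral (h : IsLocalDefining k G W) (hz : z ∈ W) (hG : G z = 0) {w : E}
    (hw : fderiv ℝ G z (0, w) ≠ 0) :
    Module.finrank ℝ (Umbral k G z) + 2 = Module.finrank ℝ E := by
  let β : Module.Dual ℝ E := ((fderiv ℝ G z).comp (ContinuousLinearMap.inr ℝ E E)).toLinearMap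
  have hβ : ∀ a, β a = fderiv ℝ G z (0, a) := fun a => rfl
  have hβ0 : β ≠ 0 := fun h0 => hw (by rw [← hβ, h0]; rfl)
  let K := LinearMap.ker β
  let L : Submodule ℝ E := Submodule.span ℝ {z.2}
  have hLK : L ≤ K := by
    rw [Submodule.span_singleton_le_iff_mem, LinearMap.mem_ker, hβ, h.euler z hz, hG, mul_zero]
  let π : lamCone G z →ₗ[ℝ] K :=
    ((LinearMap.fst ℝ E E).comp (lamCone G z).subtype).codRestrict K fun X =>
      (mem_lamCone.1 X.2).2
  let f : lamCone G z →ₗ[ℝ] K ⧸ L.submoduleOf K := (L.submoduleOf K).mkQ.comp π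
  have hf : Function.Surjective f := by
    intro y
    obtain ⟨⟨a, ha⟩, rfl⟩ := Submodule.mkQ_surjective _ y
    obtain ⟨X, hX, hXa⟩ := exists_mem_lamCone hw (show fderiv ℝ G z (0, a) = 0 from ha)
    exact ⟨⟨X, hX⟩, congrArg (L.submoduleOf K).mkQ (Subtype.ext hXa)⟩
  have hker : LinearMap.ker f = (nullCone k G z).submoduleOf (lamCone G z) := by
    ext X
    have h1 : f X = 0 ↔ (X : E × E).1 ∈ L := Submodule.Quotient.mk_eq_zero _
    have h2 : X ∈ (nullCone k G z).submoduleOf (lamCone G z) ↔ (X : E × E) ∈ nullCone k G z :=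
      Iff.rfl
    rw [LinearMap.mem_ker, h1, h2, h.mem_nullCone hz, Submodule.mem_span_singleton]
    constructor
    · rintro ⟨t, ht⟩
      exact ⟨(mem_lamCone.1 X.2).1, t, ht.symm⟩
    · rintro ⟨-, t, ht⟩
      exact ⟨t, ht.symm⟩
  have h1 : Module.finrank ℝ (Umbral k G z) = Module.finrank ℝ (K ⧸ L.submoduleOf K) := by
    rw [← (f.quotKerEquivOfSurjective hf).finrank_eq, hker]
  have h2 := (L.submoduleOf K).finrank_quotient_add_finrank
  have h3 : Module.finrank ℝ (L.submoduleOf K) = 1 := by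
    rw [(Submodule.submoduleOfEquivOfLe hLK).finrank_eq,
      finrank_span_singleton (h.snd_ne_zero hz hw)]
  have h4 : Module.finrank ℝ K + 1 = Module.finrank ℝ E :=
    Module.Dual.finrank_ker_add_one_of_ne_zero hβ0
  omega

theorem umbralWellDefined (h : IsLocalDefining k G W) (hz : z ∈ W) (hG : G z = 0) {w : E}
    (hw : fderiv ℝ G z (0, w) ≠ 0) : UmbralWellDefined k G z where
  null_le X hX := by
    obtain ⟨h1, t, ht⟩ := (h.mem_nullCone hz).1 hX
    refine mem_lamCone.2 ⟨h1, ?_⟩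
    have : ((0, X.1) : E × E) = t • (0, z.2) := by simp [ht]
    rw [this, map_smul, h.euler z hz, hG, mul_zero, smul_zero]
  mem_null_iff X hX := by
    rw [h.mem_nullCone hz]
    constructor
    · rintro ⟨-, t, ht⟩ Y hY
      rw [gH_apply, ht, h.fibreHess_smul_euler hz, (mem_lamCone.1 hY).2, mul_zero, mul_zero]
    · intro h0
      refine ⟨(mem_lamCone.1 hX).1, h.eq_smul_of_fibreHess_eq_zero hz hw fun b hb => ?_⟩
      obtain ⟨Y, hY, rfl⟩ := exists_mem_lamCone hw hb
      exact h0 Y hY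
  finrank_eq := h.finrank_umbral hz hG hw
  tidal_symm := h.tidal_symm hz
  tidal_null X hX Y := by
    obtain ⟨-, t, ht⟩ := (h.mem_nullCone hz).1 hX
    exact h.tidal_eq_zero_of_fst_eq_smul hz ht Y

theorem umbralMetric_mk (h : IsLocalDefining k G W) (hz : z ∈ W) (X Y : lamCone G z) :
    umbralMetric k G z (Submodule.mkQ _ X) (Submodule.mkQ _ Y) =
      fibreHess G z (X : E × E).1 (Y : E × E).1 := by
  refine descend_mk (fun X hX Y => ?_) X Y
  obtain ⟨-, t, ht⟩ := (h.mem_nullCone hz).1 hX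
  have h1 : fibreHess G z (X : E × E).1 (Y : E × E).1 = 0 := by
    have h2 := h.fibreHess_smul_euler hz t (Y : E × E).1
    rw [← ht, (mem_lamCone.1 Y.2).2, mul_zero, mul_zero] at h2
    exact h2
  exact ⟨h1, (h.fibreHess_symm hz _ _).trans h1⟩

theorem umbralTidal_mk (h : IsLocalDefining k G W) (hz : z ∈ W) (X Y : lamCone G z) :
    umbralTidal k G z (Submodule.mkQ _ X) (Submodule.mkQ _ Y) =
      tidal k G z (X : E × E) (Y : E × E) := by
  refine descend_mk (fun X hX Y => ?_) X Y
  obtain ⟨-, t, ht⟩ := (h.mem_nullCone hz).1 hX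
  have h1 := h.tidal_eq_zero_of_fst_eq_smul hz ht Y
  exact ⟨h1, (h.tidal_symm hz _ _).trans h1⟩

theorem umbralMetric_nondegenerate (h : IsLocalDefining k G W) (hz : z ∈ W) {w : E}
    (hw : fderiv ℝ G z (0, w) ≠ 0) : (umbralMetric k G z).Nondegenerate := by
  have key : ∀ X : lamCone G z, (∀ Y : lamCone G z,
      fibreHess G z (X : E × E).1 (Y : E × E).1 = 0) →
      Submodule.mkQ ((nullCone k G z).submoduleOf (lamCone G z)) X = 0 := by
    intro X h0
    rw [Submodule.mkQ_apply, Submodule.Quotient.mk_eq_zero]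
    refine (h.mem_nullCone hz).2
      ⟨(mem_lamCone.1 X.2).1, h.eq_smul_of_fibreHess_eq_zero hz hw fun b hb => ?_⟩
    obtain ⟨Y, hY, rfl⟩ := exists_mem_lamCone hw hb
    exact h0 ⟨Y, hY⟩
  constructor
  · intro X hX
    obtain ⟨X, rfl⟩ := Submodule.mkQ_surjective _ X
    refine key X fun Y => ?_
    rw [← h.umbralMetric_mk hz]
    exact hX _
  · intro X hX
    obtain ⟨X, rfl⟩ := Submodule.mkQ_surjective _ X
    refine key X fun Y => ?_
    rw [h.fibreHess_symm hz, ← h.umbralMetric_mk hz]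
    exact hX _

end IsLocalDefining

namespace IsLocalConformal

variable [FiniteDimensional ℝ E]

/-- The Weyl tensors of `G` and `J G` agree. -/
theorem weylAgree (h : IsLocalConformal k q G G' J W) (hz : z ∈ W) (hG : G z = 0) {w : E}
    (hw : fderiv ℝ G z (0, w) ≠ 0) :
    WeylAgree k G (k + q) G' (J z) z := by
  have hJ := h.ne_zero z hz
  have hdG : fderiv ℝ G z ≠ 0 := fun h0 => hw (by rw [h0]; rfl)
  have hd : ∀ X, fderiv ℝ G' z X = 0 ↔ fderiv ℝ G z X = 0 := fun X => by
    rw [h.fderiv_mul_apply hz hG, mul_eq_zero, or_iff_right hJ]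
  have hΛ : lamCone G z = lamCone G' z := by
    ext X
    rw [mem_lamCone, mem_lamCone, hd, hd]
  have hN : nullCone k G z = nullCone (k + q) G' z := by
    ext X
    rw [h.left.mem_nullCone hz, h.right.mem_nullCone hz, hd]
  have hmk : ∀ X : lamCone G z, umbralCongr hΛ hN (Submodule.mkQ _ X) =
      Submodule.mkQ _ (⟨X, hΛ ▸ X.2⟩ : lamCone G' z) := fun X => rfl
  have hgH : ∀ X Y : lamCone G z, fibreHess G' z (X : E × E).1 (Y : E × E).1 =
      J z * fibreHess G z (X : E × E).1 (Y : E × E).1 := by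
    intro X Y
    rw [fibreHess_apply, h.fderiv_fderiv hz,
      ← fibreHess_apply, (mem_lamCone.1 X.2).2, (mem_lamCone.1 Y.2).2, hG]
    ring
  obtain ⟨κ, hκ⟩ := h.exists_tidal_diag hz hG hdG
  have hS : ∀ X Y : lamCone G z, tidal (k + q) G' z (X : E × E) (Y : E × E) =
      J z * tidal k G z (X : E × E) (Y : E × E) +
        κ * fibreHess G z (X : E × E).1 (Y : E × E).1 := by
    intro X Y
    -- Polarisation: the comparison is known on the diagonal and all forms involved are symmetric.
    have h1 := hκ X (mem_lamCone.1 X.2).2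
    have h2 := hκ Y (mem_lamCone.1 Y.2).2
    have h3 := hκ (X + Y : lamCone G z) (mem_lamCone.1 (X + Y).2).2
    simp only [Submodule.coe_add, Prod.fst_add, map_add, add_apply] at h3
    rw [h.right.tidal_symm hz Y X, h.left.tidal_symm hz Y X,
      h.left.fibreHess_symm hz (Y : E × E).1] at h3
    linear_combination (1 / 2) * (h3 - h1 - h2)
  have hg' : ∀ X Y, umbralMetric (k + q) G' z (umbralCongr hΛ hN X)
      (umbralCongr hΛ hN Y) = J z * umbralMetric k G z X Y := by
    intro X Y
    obtain ⟨X, rfl⟩ := Submodule.mkQ_surjective _ X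
    obtain ⟨Y, rfl⟩ := Submodule.mkQ_surjective _ Y
    rw [hmk, hmk, h.right.umbralMetric_mk hz, h.left.umbralMetric_mk hz]
    exact hgH X Y
  have hs' : ∀ X Y, umbralTidal (k + q) G' z (umbralCongr hΛ hN X)
      (umbralCongr hΛ hN Y) = J z * umbralTidal k G z X Y + κ * umbralMetric k G z X Y := by
    intro X Y
    obtain ⟨X, rfl⟩ := Submodule.mkQ_surjective _ X
    obtain ⟨Y, rfl⟩ := Submodule.mkQ_surjective _ Y
    rw [hmk, hmk, h.right.umbralTidal_mk hz, h.left.umbralTidal_mk hz, h.left.umbralMetric_mk hz]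
    exact hS X Y
  have hnd := h.left.umbralMetric_nondegenerate hz hw
  have hn : (Module.finrank ℝ (Umbral k G z) : ℝ) = (Module.finrank ℝ E : ℝ) - 2 := by
    rw [← h.left.finrank_umbral hz hG hw]
    push_cast
    ring
  have hW : ∀ X Y, weylForm (k + q) G' z (umbralCongr hΛ hN X)
      (umbralCongr hΛ hN Y) = J z * weylForm k G z X Y :=
    traceFree_of_equiv (umbralCongr hΛ hN) hJ hnd hg' hs' hn
  refine ⟨hΛ, hN, ?_, hg', hW⟩
  have h1 := raiseIndex_conj (umbralCongr hΛ hN) (κ := 0) hJ hnd hg'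
    (fun X Y => by rw [hW X Y, zero_mul, add_zero])
  rwa [zero_div, zero_smul, add_zero] at h1

end IsLocalConformal

end Umbral

/-! ## Charts of the tangent bundle -/

section Manifold

variable {E : Type*} [NormedAddCommGroup E] [NormedSpace ℝ E]
variable {M : Type*} [TopologicalSpace M] [ChartedSpace E M]

/-- The point of the tangent bundle with given coordinates in a chart. -/
def ofChart (φ : OpenPartialHomeomorph M E) (z : E × E) : TangentBundle 𝓘(ℝ, E) M :=
  ⟨φ.symm z.1, mfderiv 𝓘(ℝ, E) 𝓘(ℝ, E) φ.symm z.1 z.2⟩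

theorem ofChart_smul (φ : OpenPartialHomeomorph M E) (z : E × E) (t : ℝ) :
    ofChart φ (z.1, t • z.2) = ⟨(ofChart φ z).1, t • (ofChart φ z).2⟩ :=
  congrArg (Bundle.TotalSpace.mk (φ.symm z.1))
    ((mfderiv 𝓘(ℝ, E) 𝓘(ℝ, E) φ.symm z.1).map_smul t z.2)

theorem tangentBundle_mk_eq {x y : M} {v w : E} (hxy : x = y) (hvw : v = w) :
    (⟨x, v⟩ : TangentBundle 𝓘(ℝ, E) M) = ⟨y, w⟩ := by
  subst hxy hvw
  rfl

variable {φ : OpenPartialHomeomorph M E}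

/-- The chain rule for `φ.symm ∘ φ`, which is the identity near the base point. -/
theorem ofChart_chartPt (hφ : φ ∈ IsManifold.maximalAtlas 𝓘(ℝ, E) ∞ M)
    {q : TangentBundle 𝓘(ℝ, E) M} (hq : q.1 ∈ φ.source) : ofChart φ (chartPt φ q) = q := by
  have h1 : MDifferentiableAt 𝓘(ℝ, E) 𝓘(ℝ, E) φ q.1 :=
    (contMDiffAt_of_mem_maximalAtlas hφ hq).mdifferentiableAt (by simp)
  have h2 : MDifferentiableAt 𝓘(ℝ, E) 𝓘(ℝ, E) φ.symm (φ q.1) :=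
    (contMDiffAt_symm_of_mem_maximalAtlas hφ (φ.map_source hq)).mdifferentiableAt (by simp)
  have h3 : (φ.symm ∘ φ) =ᶠ[𝓝 q.1] id :=
    Filter.eventuallyEq_of_mem (φ.open_source.mem_nhds hq) fun x hx => φ.left_inv hx
  have h4 : tangentMap 𝓘(ℝ, E) 𝓘(ℝ, E) (φ.symm ∘ φ) q =
      tangentMap 𝓘(ℝ, E) 𝓘(ℝ, E) φ.symm (tangentMap 𝓘(ℝ, E) 𝓘(ℝ, E) φ q) :=
    tangentMap_comp_at q h2 h1
  refine (h4.symm.trans ?_ : ofChart φ (chartPt φ q) = q)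
  refine tangentBundle_mk_eq (φ.left_inv hq) ?_
  have h5 := h3.mfderiv_eq (I := 𝓘(ℝ, E)) (I' := 𝓘(ℝ, E))
  rw [mfderiv_id] at h5
  exact DFunLike.congr_fun h5 q.2

theorem chartPt_mem (hφ : φ ∈ IsManifold.maximalAtlas 𝓘(ℝ, E) ∞ M)
    {U : Set (TangentBundle 𝓘(ℝ, E) M)} {q : TangentBundle 𝓘(ℝ, E) M} (hq : q.1 ∈ φ.source)
    (hqU : q ∈ U) : chartPt φ q ∈ φ.target ×ˢ (Set.univ : Set E) ∩ ofChart φ ⁻¹' U := by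
  refine ⟨⟨φ.map_source hq, trivial⟩, ?_⟩
  rw [Set.mem_preimage, ofChart_chartPt hφ hq]
  exact hqU

theorem inChart_chartPt (hφ : φ ∈ IsManifold.maximalAtlas 𝓘(ℝ, E) ∞ M)
    (G : TangentBundle 𝓘(ℝ, E) M → ℝ) {q : TangentBundle 𝓘(ℝ, E) M} (hq : q.1 ∈ φ.source) :
    inChart φ G (chartPt φ q) = G q :=
  congrArg G (ofChart_chartPt hφ hq)

/-- The restriction of a function to a fibre, in coordinates. -/
theorem onFibre_eq (hφ : φ ∈ IsManifold.maximalAtlas 𝓘(ℝ, E) ∞ M)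
    (G : TangentBundle 𝓘(ℝ, E) M → ℝ) {x : M} (hx : x ∈ φ.source) (w : E) :
    onFibre G x w = inChart φ G (φ x, mfderiv 𝓘(ℝ, E) 𝓘(ℝ, E) φ x w) :=
  (inChart_chartPt hφ G (q := ⟨x, w⟩) hx).symm

/-- Injectivity follows from the left inverse of `chartPt`, and dimensions are finite. -/
theorem mfderiv_surjective [FiniteDimensional ℝ E]
    (hφ : φ ∈ IsManifold.maximalAtlas 𝓘(ℝ, E) ∞ M) {x : M} (hx : x ∈ φ.source) (b : E) :
    ∃ a : E, mfderiv 𝓘(ℝ, E) 𝓘(ℝ, E) φ x a = b := by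
  let A : E →L[ℝ] E := mfderiv 𝓘(ℝ, E) 𝓘(ℝ, E) φ x
  have hinj : Function.Injective A.toLinearMap := by
    intro v w hvw
    have h1 := ofChart_chartPt hφ (q := ⟨x, v⟩) hx
    have h2 := ofChart_chartPt hφ (q := ⟨x, w⟩) hx
    have h3 : chartPt φ (⟨x, v⟩ : TangentBundle 𝓘(ℝ, E) M) = chartPt φ ⟨x, w⟩ :=
      congrArg (Prod.mk (φ x)) hvw
    rw [h3, h2] at h1
    exact (Bundle.TotalSpace.mk_injective x h1).symm
  exact LinearMap.injective_iff_surjective.1 hinj b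

variable [IsManifold 𝓘(ℝ, E) ∞ M]

/-- Over the target, `ofChart φ` is the tangent map of `φ.symm` composed with the identification of
`E × E` with `TE`. -/
theorem contMDiffOn_ofChart (hφ : φ ∈ IsManifold.maximalAtlas 𝓘(ℝ, E) ∞ M) :
    ContMDiffOn 𝓘(ℝ, E × E) 𝓘(ℝ, E).tangent ∞ (ofChart φ) (φ.target ×ˢ Set.univ) := by
  have h1 : ContMDiffOn 𝓘(ℝ, E).tangent 𝓘(ℝ, E).tangent ∞
      (tangentMapWithin 𝓘(ℝ, E) 𝓘(ℝ, E) φ.symm φ.target)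
      (Bundle.TotalSpace.proj ⁻¹' φ.target) := by
    have : IsManifold 𝓘(ℝ, E) 1 M := IsManifold.of_le (n := ∞) (by simp)
    exact (contMDiffOn_symm_of_mem_maximalAtlas hφ).contMDiffOn_tangentMapWithin (by simp)
      φ.open_target.uniqueMDiffOn
  have h2 : ContMDiff 𝓘(ℝ, E × E) 𝓘(ℝ, E).tangent ∞
      (fun z : E × E => (⟨z.1, z.2⟩ : TangentBundle 𝓘(ℝ, E) E)) := fun z =>
    Bundle.contMDiffAt_totalSpace.2 ⟨contDiff_fst.contMDiff.contMDiffAt, by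
      simpa using contDiff_snd.contMDiff.contMDiffAt⟩
  have h3 := h1.comp h2.contMDiffOn (s := φ.target ×ˢ Set.univ) (fun z hz => hz.1)
  refine h3.congr fun z hz => ?_
  refine tangentBundle_mk_eq rfl ?_
  rw [mfderivWithin_of_isOpen φ.open_target hz.1]

theorem contDiffOn_inChart (hφ : φ ∈ IsManifold.maximalAtlas 𝓘(ℝ, E) ∞ M)
    {U : Set (TangentBundle 𝓘(ℝ, E) M)} {G : TangentBundle 𝓘(ℝ, E) M → ℝ}
    (hG : ContMDiffOn 𝓘(ℝ, E).tangent 𝓘(ℝ, ℝ) ∞ G U) :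
    ContDiffOn ℝ ∞ (inChart φ G) (φ.target ×ˢ Set.univ ∩ ofChart φ ⁻¹' U) :=
  contMDiffOn_iff_contDiffOn.1
    (hG.comp ((contMDiffOn_ofChart hφ).mono Set.inter_subset_left) fun _ hz => hz.2)

theorem isOpen_chartDomain (hφ : φ ∈ IsManifold.maximalAtlas 𝓘(ℝ, E) ∞ M)
    {U : Set (TangentBundle 𝓘(ℝ, E) M)} (hU : IsOpen U) :
    IsOpen (φ.target ×ˢ (Set.univ : Set E) ∩ ofChart φ ⁻¹' U) :=
  (contMDiffOn_ofChart hφ).continuousOn.isOpen_inter_preimage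
    (φ.open_target.prod isOpen_univ) hU

/-- Homogeneity is differentiated in `t` at `t = 1`; `ofChart` is linear on fibres. -/
theorem fderiv_inChart_euler (hφ : φ ∈ IsManifold.maximalAtlas 𝓘(ℝ, E) ∞ M)
    {U : Set (TangentBundle 𝓘(ℝ, E) M)} {G : TangentBundle 𝓘(ℝ, E) M → ℝ} {k : ℝ}
    (hU : IsOpen U) (hG : ContMDiffOn 𝓘(ℝ, E).tangent 𝓘(ℝ, ℝ) ∞ G U) (hk : HomogeneousOn U k G)
    {z : E × E} (hz : z ∈ φ.target ×ˢ (Set.univ : Set E) ∩ ofChart φ ⁻¹' U) :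
    fderiv ℝ (inChart φ G) z (0, z.2) = k * inChart φ G z := by
  have hd := (contDiffOn_inChart hφ hG).differentiableAt_of_isOpen (isOpen_chartDomain hφ hU) hz
  have h1 : HasDerivAt (fun t : ℝ => (z.1, t • z.2)) ((0 : E), z.2) 1 := by
    simpa using (hasDerivAt_const (1 : ℝ) z.1).prodMk ((hasDerivAt_id (1 : ℝ)).smul_const z.2)
  have hd' : HasFDerivAt (inChart φ G) (fderiv ℝ (inChart φ G) z) (z.1, (1 : ℝ) • z.2) := by
    rw [one_smul]
    exact hd.hasFDerivAt
  have h2 : HasDerivAt (fun t : ℝ => inChart φ G (z.1, t • z.2))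
      (fderiv ℝ (inChart φ G) z (0, z.2)) 1 := by
    have := HasFDerivAt.comp_hasDerivAt (1 : ℝ) hd' h1
    exact this
  have h3 : HasDerivAt (fun t : ℝ => t ^ k * inChart φ G z)
      (k * (1 : ℝ) ^ (k - 1) * inChart φ G z) 1 :=
    (Real.hasDerivAt_rpow_const (Or.inl one_ne_zero)).mul_const _
  have h4 : (fun t : ℝ => inChart φ G (z.1, t • z.2)) =ᶠ[𝓝 1]
      fun t : ℝ => t ^ k * inChart φ G z := by
    filter_upwards [lt_mem_nhds (zero_lt_one' ℝ)] with t ht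
    have h5 : inChart φ G (z.1, t • z.2) = G (ofChart φ (z.1, t • z.2)) := rfl
    rw [h5, ofChart_smul]
    exact hk _ hz.2 t ht
  have h5 := h2.unique (h3.congr_of_eventuallyEq h4)
  rw [h5, Real.one_rpow, mul_one]

/-- First and second fibre derivatives of a function on the tangent bundle, in coordinates. -/
theorem fderiv_onFibre (hφ : φ ∈ IsManifold.maximalAtlas 𝓘(ℝ, E) ∞ M)
    {U : Set (TangentBundle 𝓘(ℝ, E) M)} {G : TangentBundle 𝓘(ℝ, E) M → ℝ}
    (hU : IsOpen U) (hG : ContMDiffOn 𝓘(ℝ, E).tangent 𝓘(ℝ, ℝ) ∞ G U)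
    {x : M} {v : E} (hx : x ∈ φ.source) (hxU : (⟨x, v⟩ : TangentBundle 𝓘(ℝ, E) M) ∈ U) :
    (∀ a : E, fderiv ℝ (onFibre G x) v a =
      fderiv ℝ (inChart φ G) (chartPt φ ⟨x, v⟩) (0, mfderiv 𝓘(ℝ, E) 𝓘(ℝ, E) φ x a)) ∧
    ∀ a b : E, fderiv ℝ (fderiv ℝ (onFibre G x)) v a b =
      fibreHess (inChart φ G) (chartPt φ ⟨x, v⟩) (mfderiv 𝓘(ℝ, E) 𝓘(ℝ, E) φ x a)
        (mfderiv 𝓘(ℝ, E) 𝓘(ℝ, E) φ x b) := by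
  let A : E →L[ℝ] E := mfderiv 𝓘(ℝ, E) 𝓘(ℝ, E) φ x
  let f : E × E → ℝ := inChart φ G
  let O := φ.target ×ˢ (Set.univ : Set E) ∩ ofChart φ ⁻¹' U
  have hO : IsOpen O := isOpen_chartDomain hφ hU
  have hf : ContDiffOn ℝ ∞ f O := contDiffOn_inChart hφ hG
  let ι : E → E × E := fun w => (φ x, A w)
  have hιs : ContDiff ℝ ∞ ι := contDiff_const.prodMk A.contDiff
  have hιd : ∀ w, HasFDerivAt ι ((ContinuousLinearMap.inr ℝ E E).comp A) w := fun w =>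
    (hasFDerivAt_const (φ x) w).prodMk A.hasFDerivAt
  have hv : ι v ∈ O := chartPt_mem hφ hx hxU
  have hιO : IsOpen (ι ⁻¹' O) := hO.preimage hιs.continuous
  have hfib : onFibre G x = f ∘ ι := funext fun w => onFibre_eq hφ G hx w
  have hder : ∀ w ∈ ι ⁻¹' O, fderiv ℝ (f ∘ ι) w =
      (fderiv ℝ f (ι w)).comp ((ContinuousLinearMap.inr ℝ E E).comp A) := fun w hw =>
    ((hf.differentiableAt_of_isOpen hO hw).hasFDerivAt.comp w (hιd w)).fderiv
  rw [hfib]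
  refine ⟨fun a => by rw [hder _ hv]; rfl, fun a b => ?_⟩
  have h1 : (fderiv ℝ (f ∘ ι)) =ᶠ[𝓝 v] fun w =>
      (fderiv ℝ f (ι w)).comp ((ContinuousLinearMap.inr ℝ E E).comp A) :=
    Filter.eventuallyEq_of_mem (hιO.mem_nhds hv) hder
  have h2 : HasFDerivAt (fun w => fderiv ℝ f (ι w))
      ((fderiv ℝ (fderiv ℝ f) (ι v)).comp ((ContinuousLinearMap.inr ℝ E E).comp A)) v :=
    (((contDiffOn_fderiv hf hO).differentiableAt_of_isOpen hO hv).hasFDerivAt).comp v (hιd v)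
  rw [h1.fderiv_eq,
    (h2.clm_comp (hasFDerivAt_const ((ContinuousLinearMap.inr ℝ E E).comp A) v)).fderiv]
  simp
  rfl

/-! ## Defining functions in a chart -/

/-- A nondegenerate fibre Hessian stays nondegenerate nearby. -/
theorem exists_nondegenerate_nhds [FiniteDimensional ℝ E] {G : E × E → ℝ} {O : Set (E × E)}
    (hO : IsOpen O) (hG : ContDiffOn ℝ ∞ G O) {z : E × E} (hz : z ∈ O)
    (hnd : ∀ u : E, (∀ w : E, fibreHess G z u w = 0) → u = 0) :
    ∃ W ⊆ O, IsOpen W ∧ z ∈ W ∧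
      ∀ y ∈ W, ∀ u : E, (∀ w : E, fibreHess G y u w = 0) → u = 0 := by
  have hc : ContinuousOn (fibreHess G) O :=
    (contDiffOn_bilinearComp (contDiffOn_fderiv (contDiffOn_fderiv hG hO) hO) contDiffOn_const
      contDiffOn_const).continuousOn
  have hinj : Function.Injective (fibreHess G z).toLinearMap := by
    rw [← LinearMap.ker_eq_bot, LinearMap.ker_eq_bot']
    exact fun u hu => hnd u fun w => DFunLike.congr_fun hu w
  have hdim : Module.finrank ℝ E = Module.finrank ℝ (E →L[ℝ] ℝ) := by
    rw [← (LinearMap.toContinuousLinearMap (𝕜 := ℝ) (E := E) (F' := ℝ)).finrank_eq,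
      Subspace.dual_finrank_eq]
  let e := (LinearEquiv.ofInjectiveOfFinrankEq (fibreHess G z).toLinearMap hinj
    hdim).toContinuousLinearEquiv
  -- The Hessian is an isomorphism onto the dual at `z`, and invertible continuous linear maps form
  -- an open set.
  refine ⟨O ∩ fibreHess G ⁻¹' Set.range ((↑) : (E ≃L[ℝ] (E →L[ℝ] ℝ)) → E →L[ℝ] E →L[ℝ] ℝ),
    Set.inter_subset_left, hc.isOpen_inter_preimage hO ContinuousLinearEquiv.isOpen,
    ⟨hz, e, rfl⟩, ?_⟩
  rintro y ⟨-, e', he'⟩ u hu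
  refine e'.injective ?_
  rw [map_zero]
  refine ContinuousLinearMap.ext fun w => ?_
  refine Eq.trans ?_ (hu w)
  rw [← he']
  rfl

variable {𝓗 U : Set (TangentBundle 𝓘(ℝ, E) M)} {k : ℝ} {G : TangentBundle 𝓘(ℝ, E) M → ℝ}
variable {q : TangentBundle 𝓘(ℝ, E) M}

theorem IsDefiningFunction.exists_fderiv_ne_zero (h : IsDefiningFunction 𝓗 U k G)
    (hφ : φ ∈ IsManifold.maximalAtlas 𝓘(ℝ, E) ∞ M) (hq : q.1 ∈ φ.source) (hqU : q ∈ 𝓗 ∩ U) :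
    ∃ w : E, fderiv ℝ (inChart φ G) (chartPt φ q) (0, w) ≠ 0 := by
  by_contra! h0
  refine h.fderiv_ne_zero q hqU (ContinuousLinearMap.ext fun a => ?_)
  exact ((fderiv_onFibre hφ h.conic.isOpen h.smooth (x := q.1) (v := q.2) hq hqU.2).1 a).trans
    (h0 _)

theorem IsDefiningFunction.inChart_eq_zero (h : IsDefiningFunction 𝓗 U k G)
    (hφ : φ ∈ IsManifold.maximalAtlas 𝓘(ℝ, E) ∞ M) (hq : q.1 ∈ φ.source) (hqU : q ∈ 𝓗 ∩ U) :
    inChart φ G (chartPt φ q) = 0 := by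
  rw [inChart_chartPt hφ G hq]
  exact (h.zero_iff q hqU.2).2 hqU.1

variable [FiniteDimensional ℝ E]

theorem fibreHess_inChart_nondegenerate (hφ : φ ∈ IsManifold.maximalAtlas 𝓘(ℝ, E) ∞ M)
    (hU : IsOpen U) (hG : ContMDiffOn 𝓘(ℝ, E).tangent 𝓘(ℝ, ℝ) ∞ G U)
    (hq : q.1 ∈ φ.source) (hqU : q ∈ U) :
    (∀ u : E, (∀ w : E, fibreHess (inChart φ G) (chartPt φ q) u w = 0) → u = 0) ↔
      ∀ u : E, (∀ w : E, fderiv ℝ (fderiv ℝ (onFibre G q.1)) q.2 u w = 0) → u = 0 := by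
  have hH := (fderiv_onFibre hφ hU hG (x := q.1) (v := q.2) hq hqU).2
  have hsurj := mfderiv_surjective hφ hq
  let A : E →L[ℝ] E := mfderiv 𝓘(ℝ, E) 𝓘(ℝ, E) φ q.1
  have hinj : Function.Injective A.toLinearMap := LinearMap.injective_iff_surjective.2 hsurj
  constructor
  · intro h u hu
    refine hinj ((h (A u) fun w => ?_).trans (map_zero A).symm)
    obtain ⟨b, rfl⟩ := hsurj w
    exact (hH u b).symm.trans (hu b)
  · intro h u hu
    obtain ⟨a, rfl⟩ := hsurj u
    rw [h a fun w => (hH a w).trans (hu _)]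
    exact map_zero A

/-- Near a point of the cone, a defining function is a local defining function in every chart. -/
theorem IsDefiningFunction.exists_isLocalDefining (h : IsDefiningFunction 𝓗 U k G)
    (hφ : φ ∈ IsManifold.maximalAtlas 𝓘(ℝ, E) ∞ M) (hq : q.1 ∈ φ.source) (hqU : q ∈ 𝓗 ∩ U) :
    ∃ W ⊆ φ.target ×ˢ (Set.univ : Set E) ∩ ofChart φ ⁻¹' U, chartPt φ q ∈ W ∧
      IsLocalDefining k (inChart φ G) W := by
  have hU := h.conic.isOpen
  have hs := contDiffOn_inChart hφ h.smooth
  obtain ⟨W, hsub, hW, hzW, hnd⟩ := exists_nondegenerate_nhds (isOpen_chartDomain hφ hU) hs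
    (chartPt_mem hφ hq hqU.2) ((fibreHess_inChart_nondegenerate hφ hU h.smooth hq hqU.2).2
      (h.hessian_nondegenerate q hqU))
  exact ⟨W, hsub, hzW, hW, h.degree_ne_one, hs.mono hsub,
    fun z hz => fderiv_inChart_euler hφ hU h.smooth h.homogeneous (hsub hz), hnd⟩

end Manifold

/-! ## Comparing two defining functions -/

section Comparison

variable {E : Type*} [NormedAddCommGroup E] [NormedSpace ℝ E]
variable {k q : ℝ} {G G' J : E × E → ℝ} {W : Set (E × E)} {z : E × E}

/-- A smooth quotient of two homogeneous functions is homogeneous. -/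
theorem euler_of_eq_mul (hW : IsOpen W) (hG : ContDiffOn ℝ ∞ G W) (hJ : ContDiffOn ℝ ∞ J W)
    (hGe : ∀ y ∈ W, fderiv ℝ G y (0, y.2) = k * G y)
    (hGe' : ∀ y ∈ W, fderiv ℝ G' y (0, y.2) = (k + q) * G' y)
    (hmul : ∀ y ∈ W, G' y = J y * G y) (hdG : ∀ y ∈ W, fderiv ℝ G y ≠ 0) (hz : z ∈ W) :
    fderiv ℝ J z (0, z.2) = q * J z := by
  -- The defect `e` satisfies `e G = 0`. Off the cone `G` cancels; on it, differentiating leaves `e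
  -- dG = 0` with `dG ≠ 0`.
  let e : E × E → ℝ := fun y => lieD eulerField J y - q * J y
  have he : ContDiffOn ℝ ∞ e W :=
    (contDiffOn_lieD hW contDiff_eulerField.contDiffOn hJ).sub (contDiffOn_const.mul hJ)
  have h0 : ∀ y ∈ W, e y * G y = 0 := by
    intro y hy
    have h1 : lieD eulerField G' y = lieD eulerField (fun y => J y * G y) y :=
      lieD_congr hW hmul hy
    rw [lieD_mul (hJ.differentiableAt_of_isOpen hW hy) (hG.differentiableAt_of_isOpen hW hy)] at h1
    have h2 : lieD eulerField G' y = (k + q) * (J y * G y) := by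
      rw [← hmul y hy]
      exact hGe' y hy
    have h3 : lieD eulerField G y = k * G y := hGe y hy
    rw [h2, h3] at h1
    simp only [e]
    linear_combination -h1
  have hez : e z = 0 := by
    by_cases hGz : G z = 0
    · obtain ⟨X, hX⟩ : ∃ X, fderiv ℝ G z X ≠ 0 := by
        by_contra! h'
        exact hdG z hz (ContinuousLinearMap.ext h')
      have h1 : lieD (fun _ => X) (fun y => e y * G y) z = lieD (fun _ => X) (fun _ => (0 : ℝ)) z :=
        lieD_congr hW h0 hz
      rw [lieD_mul (he.differentiableAt_of_isOpen hW hz) (hG.differentiableAt_of_isOpen hW hz),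
        hGz] at h1
      have h2 : e z * fderiv ℝ G z X = 0 := by simpa [lieD] using h1
      exact (mul_eq_zero.1 h2).resolve_right hX
    · exact (mul_eq_zero.1 (h0 z hz)).resolve_right hGz
  exact sub_eq_zero.1 hez

/-- Generalized conformal transformations preserve nondegeneracy of the fibre Hessian along the
cone. -/
theorem IsLocalDefining.fibreHess_mul_nondegenerate (h : IsLocalDefining k G W)
    (hJ : ContDiffOn ℝ ∞ J W) (hJe : ∀ y ∈ W, fderiv ℝ J y (0, y.2) = q * J y) (hz : z ∈ W)
    (hJz : J z ≠ 0) (hGz : G z = 0) (hkq : k + q ≠ 1) (u : E)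
    (hu : ∀ w, fibreHess (fun y => J y * G y) z u w = 0) : u = 0 := by
  have hk : k - 1 ≠ 0 := sub_ne_zero.2 h.ne_one
  have hkq' : k + q - 1 ≠ 0 := sub_ne_zero.2 hkq
  have h1 : ∀ w, J z * fibreHess G z u w + fderiv ℝ J z (0, u) * fderiv ℝ G z (0, w) +
      fderiv ℝ J z (0, w) * fderiv ℝ G z (0, u) = 0 := by
    intro w
    have h2 := hu w
    rw [fibreHess_apply, fderiv_fderiv_mul h.isOpen hJ h.smooth hz, hGz, mul_zero, add_zero] at h2
    exact h2
  -- Testing with `w = v`, where `∂G/∂v (v) = k G = 0`, leaves `(k + q - 1) J ∂G/∂v (u) = 0`.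
  have h2 : fderiv ℝ G z (0, u) = 0 := by
    have h3 := h1 z.2
    rw [h.fibreHess_symm hz, h.fibreHess_euler hz, h.euler z hz, hJe z hz, hGz] at h3
    have h4 : (k + q - 1) * J z * fderiv ℝ G z (0, u) = 0 := by linear_combination h3
    exact (mul_eq_zero.1 h4).resolve_left (mul_ne_zero hkq' hJz)
  -- Now `g (u, ·)` is a multiple of `∂G/∂v`, so `u` is a multiple of `v`; the factor vanishes by a
  -- second use of `k + q ≠ 1`.
  have h3 : u = (-(fderiv ℝ J z (0, u)) / (J z * (k - 1))) • z.2 := by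
    rw [← sub_eq_zero]
    refine h.nondeg z hz _ fun w => ?_
    have h4 := h1 w
    rw [h2, mul_zero, add_zero] at h4
    rw [map_sub, sub_apply, h.fibreHess_smul_euler hz]
    field_simp
    linear_combination h4
  have h4 : fderiv ℝ J z (0, u) = 0 := by
    have h5 : ((0, u) : E × E) = (-(fderiv ℝ J z (0, u)) / (J z * (k - 1))) • (0, z.2) := by
      rw [Prod.smul_mk, smul_zero, ← h3]
    have h6 := congrArg (fderiv ℝ J z) h5
    rw [map_smul, hJe z hz, smul_eq_mul] at h6
    field_simp at h6
    have h7 : (k + q - 1) * fderiv ℝ J z (0, u) = 0 := by linear_combination h6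
    exact (mul_eq_zero.1 h7).resolve_left hkq'
  rw [h3, h4, neg_zero, zero_div, zero_smul]

variable [FiniteDimensional ℝ E]

/-- Two local defining functions with the same zero set differ by a smooth nowhere zero homogeneous
factor. -/
theorem IsLocalDefining.exists_isLocalConformal (h : IsLocalDefining k G W)
    (h' : IsLocalDefining (k + q) G' W) (hz : z ∈ W) (hGz : G z = 0)
    (h0 : ∀ y ∈ W, G y = 0 → G' y = 0) (hdG : fderiv ℝ G z ≠ 0) (hdG' : fderiv ℝ G' z ≠ 0) :
    ∃ (J : E × E → ℝ) (W' : Set (E × E)), z ∈ W' ∧ IsLocalConformal k q G G' J W' := by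
  -- The homogeneity of the quotient needs `dG ≠ 0` throughout the neighbourhood, not only at `z`.
  have hW₀ : IsOpen (W ∩ fderiv ℝ G ⁻¹' {0}ᶜ) :=
    h.contDiffOn_fderiv.continuousOn.isOpen_inter_preimage h.isOpen isOpen_compl_singleton
  obtain ⟨W₁, hW₁, hzW₁, hsub, J, hJ, hmul⟩ := exists_factor hW₀
    (h'.smooth.mono Set.inter_subset_left) (h.smooth.mono Set.inter_subset_left)
    (show z ∈ W ∩ fderiv ℝ G ⁻¹' {0}ᶜ from ⟨hz, hdG⟩) hGz hdG fun y hy => h0 y hy.1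
  have hW₂ : IsOpen (W₁ ∩ J ⁻¹' {0}ᶜ) :=
    hJ.continuousOn.isOpen_inter_preimage hW₁ isOpen_compl_singleton
  have hsub₁ : W₁ ⊆ W := fun y hy => (hsub hy).1
  have hsub₂ : W₁ ∩ J ⁻¹' {0}ᶜ ⊆ W := fun y hy => hsub₁ hy.1
  have hJz : J z ≠ 0 := by
    intro hJz
    refine hdG' (ContinuousLinearMap.ext fun X => ?_)
    have h1 := lieD_mul (X := fun _ => X) (hJ.differentiableAt_of_isOpen hW₁ hzW₁)
      ((h.smooth.mono hsub₁).differentiableAt_of_isOpen hW₁ hzW₁)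
    rw [hGz, hJz, zero_mul, mul_zero, add_zero] at h1
    exact (lieD_congr (X := fun _ => X) hW₁ hmul hzW₁).trans h1
  refine ⟨J, W₁ ∩ J ⁻¹' {0}ᶜ, ⟨hzW₁, hJz⟩, h.mono hW₂ hsub₂, h'.mono hW₂ hsub₂,
    hJ.mono Set.inter_subset_left, fun y hy => ?_, fun y hy => hy.2, fun y hy => hmul y hy.1⟩
  exact euler_of_eq_mul hW₁ (h.smooth.mono hsub₁) hJ (fun x hx => h.euler x (hsub₁ hx))
    (fun x hx => h'.euler x (hsub₁ hx)) hmul (fun x hx => (hsub hx).2) hy.1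

end Comparison

/-! ### From charts back to the tangent bundle -/

section Main

variable {E : Type*} [NormedAddCommGroup E] [NormedSpace ℝ E] [FiniteDimensional ℝ E]
variable {M : Type*} [TopologicalSpace M] [ChartedSpace E M] [IsManifold 𝓘(ℝ, E) ∞ M]
variable {𝓗 U U' : Set (TangentBundle 𝓘(ℝ, E) M)} {k r : ℝ}
variable {G G' J : TangentBundle 𝓘(ℝ, E) M → ℝ} {q : TangentBundle 𝓘(ℝ, E) M}
variable {φ : OpenPartialHomeomorph M E}

/-- In every chart, two defining functions of the same cone differ by a smooth factor. -/
theorem IsDefiningFunction.exists_isLocalConformal (h : IsDefiningFunction 𝓗 U k G)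
    (h' : IsDefiningFunction 𝓗 U' (k + r) G') (hφ : φ ∈ IsManifold.maximalAtlas 𝓘(ℝ, E) ∞ M)
    (hq : q.1 ∈ φ.source) (hqU : q ∈ 𝓗 ∩ (U ∩ U')) :
    ∃ (J : E × E → ℝ) (W : Set (E × E)), chartPt φ q ∈ W ∧
      IsLocalConformal k r (inChart φ G) (inChart φ G') J W := by
  have hqU₁ : q ∈ 𝓗 ∩ U := ⟨hqU.1, hqU.2.1⟩
  have hqU₂ : q ∈ 𝓗 ∩ U' := ⟨hqU.1, hqU.2.2⟩
  obtain ⟨W₁, hsub₁, hz₁, hW₁⟩ := h.exists_isLocalDefining hφ hq hqU₁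
  obtain ⟨W₂, hsub₂, hz₂, hW₂⟩ := h'.exists_isLocalDefining hφ hq hqU₂
  obtain ⟨w₁, hw₁⟩ := h.exists_fderiv_ne_zero hφ hq hqU₁
  obtain ⟨w₂, hw₂⟩ := h'.exists_fderiv_ne_zero hφ hq hqU₂
  have hW := hW₁.isOpen.inter hW₂.isOpen
  exact (hW₁.mono hW Set.inter_subset_left).exists_isLocalConformal
    (hW₂.mono hW Set.inter_subset_right) ⟨hz₁, hz₂⟩ (h.inChart_eq_zero hφ hq hqU₁)
    (fun y hy hGy => (h'.zero_iff _ (hsub₂ hy.2).2).2 ((h.zero_iff _ (hsub₁ hy.1).2).1 hGy))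
    (fun h0 => hw₁ (by rw [h0]; rfl)) (fun h0 => hw₂ (by rw [h0]; rfl))

theorem IsDefiningFunction.exists_weylAgree (h : IsDefiningFunction 𝓗 U k G)
    (h' : IsDefiningFunction 𝓗 U' (k + r) G') (hqU : q ∈ 𝓗 ∩ (U ∩ U')) :
    ∃ c : ℝ, c ≠ 0 ∧ ∀ φ ∈ IsManifold.maximalAtlas 𝓘(ℝ, E) ∞ M, q.1 ∈ φ.source →
      WeylAgree k (inChart φ G) (k + r) (inChart φ G') c (chartPt φ q) := by
  have hqU₁ : q ∈ 𝓗 ∩ U := ⟨hqU.1, hqU.2.1⟩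
  have hqU₂ : q ∈ 𝓗 ∩ U' := ⟨hqU.1, hqU.2.2⟩
  obtain ⟨a, ha⟩ : ∃ a : E, fderiv ℝ (onFibre G q.1) q.2 a ≠ 0 := by
    by_contra! h0
    exact h.fderiv_ne_zero q hqU₁ (ContinuousLinearMap.ext h0)
  -- This ratio of fibre derivatives involves no chart, so one constant serves all charts; in each
  -- of them it equals the value of the local factor `J`, because `dG' = J dG` on the cone.
  set c := fderiv ℝ (onFibre G' q.1) q.2 a / fderiv ℝ (onFibre G q.1) q.2 a with hc
  have key : ∀ φ ∈ IsManifold.maximalAtlas 𝓘(ℝ, E) ∞ M, q.1 ∈ φ.source →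
      c ≠ 0 ∧ WeylAgree k (inChart φ G) (k + r) (inChart φ G') c (chartPt φ q) := by
    intro φ hφ hq
    obtain ⟨J, W, hz, hJ⟩ := h.exists_isLocalConformal h' hφ hq hqU
    have hGz := h.inChart_eq_zero hφ hq hqU₁
    obtain ⟨w, hw⟩ := h.exists_fderiv_ne_zero hφ hq hqU₁
    have h1 : fderiv ℝ (onFibre G q.1) q.2 a = fderiv ℝ (inChart φ G) (chartPt φ q)
        (0, mfderiv 𝓘(ℝ, E) 𝓘(ℝ, E) φ q.1 a) :=
      (fderiv_onFibre hφ h.conic.isOpen h.smooth (x := q.1) (v := q.2) hq hqU₁.2).1 a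
    have h2 : fderiv ℝ (onFibre G' q.1) q.2 a = fderiv ℝ (inChart φ G') (chartPt φ q)
        (0, mfderiv 𝓘(ℝ, E) 𝓘(ℝ, E) φ q.1 a) :=
      (fderiv_onFibre hφ h'.conic.isOpen h'.smooth (x := q.1) (v := q.2) hq hqU₂.2).1 a
    have h3 : c = J (chartPt φ q) := by
      rw [hc, div_eq_iff ha, h1, h2]
      exact hJ.fderiv_mul_apply hz hGz _
    rw [h3]
    exact ⟨hJ.ne_zero _ hz, hJ.weylAgree hz hGz hw⟩
  exact ⟨c, (key _ (IsManifold.chart_mem_maximalAtlas q.1) (mem_chart_source E q.1)).1,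
    fun φ hφ hq => (key φ hφ hq).2⟩

/-- A generalized conformal transformation of a defining function is a defining function. -/
theorem IsDefiningFunction.mul (h : IsDefiningFunction 𝓗 U k G) (hU' : IsConicOpen U')
    (hJ : ContMDiffOn 𝓘(ℝ, E).tangent 𝓘(ℝ, ℝ) ∞ J U') (hJ0 : ∀ q ∈ U', J q ≠ 0)
    (hJr : HomogeneousOn U' r J) (hkr : k + r ≠ 1) :
    IsDefiningFunction 𝓗 (U ∩ U') (k + r) (fun q => J q * G q) := by
  have hconic : IsConicOpen (U ∩ U') :=
    ⟨h.conic.isOpen.inter hU'.isOpen, fun q hq => h.conic.ne_zero q hq.1,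
      fun q hq t ht => ⟨h.conic.smul_mem q hq.1 t ht, hU'.smul_mem q hq.2 t ht⟩⟩
  have hsmooth : ContMDiffOn 𝓘(ℝ, E).tangent 𝓘(ℝ, ℝ) ∞ (fun q => J q * G q) (U ∩ U') :=
    (hJ.mono Set.inter_subset_right).mul (h.smooth.mono Set.inter_subset_left)
  have key : ∀ q ∈ 𝓗 ∩ (U ∩ U'), fderiv ℝ (onFibre (fun q => J q * G q) q.1) q.2 ≠ 0 ∧
      ∀ u : E, (∀ w : E, fderiv ℝ (fderiv ℝ (onFibre (fun q => J q * G q) q.1)) q.2 u w = 0) →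
        u = 0 := by
    intro q hqU
    have hqU₁ : q ∈ 𝓗 ∩ U := ⟨hqU.1, hqU.2.1⟩
    have hφ := IsManifold.chart_mem_maximalAtlas (I := 𝓘(ℝ, E)) (n := ∞) q.1
    have hq := mem_chart_source E q.1
    set φ := chartAt E q.1
    obtain ⟨W, hsub, hz, hW⟩ := h.exists_isLocalDefining hφ hq hqU₁
    have hO := isOpen_chartDomain hφ hU'.isOpen
    have hW' := hW.mono (hW.isOpen.inter hO) Set.inter_subset_left
    have hz' := chartPt_mem hφ hq hqU.2.2
    have hJs := (contDiffOn_inChart hφ hJ).mono (Set.inter_subset_right (s := W))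
    have hJe := fun y (hy : y ∈ W ∩ _) =>
      fderiv_inChart_euler hφ hU'.isOpen hJ hJr hy.2
    have hGz := h.inChart_eq_zero hφ hq hqU₁
    have hJz : inChart φ J (chartPt φ q) ≠ 0 := by
      rw [inChart_chartPt hφ J hq]
      exact hJ0 q hqU.2.2
    constructor
    · obtain ⟨w, hw⟩ := h.exists_fderiv_ne_zero hφ hq hqU₁
      obtain ⟨a, rfl⟩ := mfderiv_surjective hφ hq w
      intro h0
      have h1 := (fderiv_onFibre hφ hconic.isOpen hsmooth (x := q.1) (v := q.2) hq hqU.2).1 a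
      have h2 := lieD_mul (X := fun _ => ((0, mfderiv 𝓘(ℝ, E) 𝓘(ℝ, E) φ q.1 a) : E × E))
        (hJs.differentiableAt_of_isOpen hW'.isOpen ⟨hz, hz'⟩)
        (hW'.smooth.differentiableAt_of_isOpen hW'.isOpen ⟨hz, hz'⟩)
      rw [hGz, mul_zero, add_zero] at h2
      have h3 := h1.trans h2
      rw [h0] at h3
      exact mul_ne_zero hJz hw h3.symm
    · exact (fibreHess_inChart_nondegenerate hφ hconic.isOpen hsmooth hq hqU.2).1
        (hW'.fibreHess_mul_nondegenerate hJs hJe ⟨hz, hz'⟩ hJz hGz hkr)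
  refine ⟨hconic, hkr, hsmooth, fun q hq t ht => ?_, fun q hq => ?_, fun q hq => (key q hq).1,
    fun q hq => (key q hq).2⟩
  · rw [hJr q hq.2 t ht, h.homogeneous q hq.1 t ht, Real.rpow_add ht]
    ring
  · rw [mul_eq_zero, or_iff_right (hJ0 q hq.2)]
    exact h.zero_iff q hq.1

/-- Here the factor is given, so no division is needed and the constant is `J q` itself. -/
theorem IsDefiningFunction.weylAgree_mul (h : IsDefiningFunction 𝓗 U k G) (hU' : IsConicOpen U')
    (hJ : ContMDiffOn 𝓘(ℝ, E).tangent 𝓘(ℝ, ℝ) ∞ J U') (hJ0 : ∀ q ∈ U', J q ≠ 0)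
    (hJr : HomogeneousOn U' r J) (hkr : k + r ≠ 1)
    (hφ : φ ∈ IsManifold.maximalAtlas 𝓘(ℝ, E) ∞ M) (hq : q.1 ∈ φ.source)
    (hqU : q ∈ 𝓗 ∩ (U ∩ U')) :
    WeylAgree k (inChart φ G) (k + r) (inChart φ (fun q => J q * G q)) (J q) (chartPt φ q) := by
  have h' := h.mul hU' hJ hJ0 hJr hkr
  have hqU₁ : q ∈ 𝓗 ∩ U := ⟨hqU.1, hqU.2.1⟩
  obtain ⟨W₁, -, hz₁, hW₁⟩ := h.exists_isLocalDefining hφ hq hqU₁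
  obtain ⟨W₂, hsub₂, hz₂, hW₂⟩ := h'.exists_isLocalDefining hφ hq hqU
  obtain ⟨w, hw⟩ := h.exists_fderiv_ne_zero hφ hq hqU₁
  have hW := hW₁.isOpen.inter hW₂.isOpen
  have hsub : W₁ ∩ W₂ ⊆ φ.target ×ˢ (Set.univ : Set E) ∩ ofChart φ ⁻¹' U' := fun y hy =>
    ⟨(hsub₂ hy.2).1, (hsub₂ hy.2).2.2⟩
  have hconf : IsLocalConformal k r (inChart φ G) (inChart φ fun q => J q * G q) (inChart φ J)
      (W₁ ∩ W₂) :=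
    ⟨hW₁.mono hW Set.inter_subset_left, hW₂.mono hW Set.inter_subset_right,
      (contDiffOn_inChart hφ hJ).mono hsub,
      fun y hy => fderiv_inChart_euler hφ hU'.isOpen hJ hJr (hsub hy),
      fun y hy => hJ0 _ (hsub hy).2, fun y hy => rfl⟩
  have := hconf.weylAgree ⟨hz₁, hz₂⟩ (h.inChart_eq_zero hφ hq hqU₁) hw
  rwa [inChart_chartPt hφ J hq] at this

end Main

end CausalGeometry

theorem mainTheorem1
    {E : Type*} [NormedAddCommGroup E] [NormedSpace ℝ E] [FiniteDimensional ℝ E]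
    {M : Type*} [TopologicalSpace M] [ChartedSpace E M] [IsManifold 𝓘(ℝ, E) ∞ M]
    (𝓗 : Set (TangentBundle 𝓘(ℝ, E) M)) :
    -- the umbral bundle and the tensors on it are well defined
    (∀ (U : Set (TangentBundle 𝓘(ℝ, E) M)) (k : ℝ) (G : TangentBundle 𝓘(ℝ, E) M → ℝ),
      CausalGeometry.IsDefiningFunction 𝓗 U k G →
      ∀ q ∈ 𝓗 ∩ U, ∀ φ ∈ IsManifold.maximalAtlas 𝓘(ℝ, E) ∞ M, q.1 ∈ φ.source →
        CausalGeometry.UmbralWellDefined k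
          (CausalGeometry.inChart φ G) (CausalGeometry.chartPt φ q)) ∧
    -- the Weyl tensor depends only on `𝓗`
    (∀ (U U' : Set (TangentBundle 𝓘(ℝ, E) M)) (k k' : ℝ)
        (G G' : TangentBundle 𝓘(ℝ, E) M → ℝ),
      CausalGeometry.IsDefiningFunction 𝓗 U k G →
      CausalGeometry.IsDefiningFunction 𝓗 U' k' G' →
      ∀ q ∈ 𝓗 ∩ (U ∩ U'), ∃ c : ℝ, c ≠ 0 ∧
        ∀ φ ∈ IsManifold.maximalAtlas 𝓘(ℝ, E) ∞ M, q.1 ∈ φ.source →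
          CausalGeometry.WeylAgree k (CausalGeometry.inChart φ G)
            k' (CausalGeometry.inChart φ G') c (CausalGeometry.chartPt φ q)) ∧
    -- invariance under the generalized conformal transformations `G' = J G`
    (∀ (U U₁ : Set (TangentBundle 𝓘(ℝ, E) M)) (k r : ℝ)
        (G J : TangentBundle 𝓘(ℝ, E) M → ℝ),
      CausalGeometry.IsDefiningFunction 𝓗 U k G →
      CausalGeometry.IsConicOpen U₁ →
      ContMDiffOn 𝓘(ℝ, E).tangent 𝓘(ℝ, ℝ) ∞ J U₁ →
      (∀ q ∈ U₁, J q ≠ 0) →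
      CausalGeometry.HomogeneousOn U₁ r J →
      k + r ≠ 1 →
      CausalGeometry.IsDefiningFunction 𝓗 (U ∩ U₁) (k + r) (fun q => J q * G q) ∧
      ∀ q ∈ 𝓗 ∩ (U ∩ U₁), ∀ φ ∈ IsManifold.maximalAtlas 𝓘(ℝ, E) ∞ M, q.1 ∈ φ.source →
        CausalGeometry.WeylAgree k (CausalGeometry.inChart φ G)
          (k + r) (CausalGeometry.inChart φ (fun q => J q * G q)) (J q)
          (CausalGeometry.chartPt φ q)) := by
  refine ⟨fun U k G h q hq φ hφ hqφ => ?_, fun U U' k k' G G' h h' q hq => ?_,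
    fun U U₁ k r G J h hU₁ hJ hJ0 hJr hkr => ⟨h.mul hU₁ hJ hJ0 hJr hkr, fun q hq φ hφ hqφ =>
      h.weylAgree_mul hU₁ hJ hJ0 hJr hkr hφ hqφ hq⟩⟩
  · obtain ⟨W, -, hz, hW⟩ := h.exists_isLocalDefining hφ hqφ hq
    obtain ⟨w, hw⟩ := h.exists_fderiv_ne_zero hφ hqφ hq
    exact hW.umbralWellDefined hz (h.inChart_eq_zero hφ hqφ hq) hw
  · obtain ⟨r, rfl⟩ : ∃ r, k' = k + r := ⟨k' - k, by ring⟩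
    exact h.exists_weylAgree h' hq
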